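/- Let $k$ be a perfect field and let $G$ be a finite group $k$-scheme. An algebraic $k$-variety is a separated $k$-scheme of finite type, and a $G$-action on it is good if every $G$-orbit is contained in an affine open subset. Let $X$ and $Y$ be algebraic $k$-varieties endowed with good $G$-actions and let $f\colon X\to Y$ be a $G$-equivariant morphism. Then the following are equivalent. (i) $f$ is a $G$-equivariant piecewise trivial fibration: there are an algebraic $k$-variety $F$ with a good $G$-action and finitely many $G$-invariant locally closed subschemes $B_i\subseteq Y$, whose underlying sets form a partition of $Y$, such that for each $i$ there is a $G$-equivariant isomorphism $X\times_Y B_i\cong B_i\times_k F$ (with the diagonal $G$-action on $B_i\times_k F$) under which $f$ corresponds to the projection $B_i\times_k F\to B_i$. (ii) There is an algebraic $k$-variety $F$ with a good $G$-action such that for every (scheme) point $y\in Y$ there is a $G_y$-equivariant isomorphism of $\kappa(y)$-schemes $X_y\cong F\times_k\kappa(y)$, where $X_y=X\times_Y\operatorname{Spec}\kappa(y)$. Here $G_y$ is the stabilizer of $y$, consisting of the elements of $G$ carrying $y$ to $y$ (they may act nontrivially on $\kappa(y)$). That is, for a $k$-scheme $T$ a $T$-point of $G_y$ is a pair $(g,t)$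 with $g\in G(T)$ and $t\in(\operatorname{Spec}\kappa(y))(T)$ such that $g\cdot t\in Y(T)$ again lies in $(\operatorname{Spec}\kappa(y))(T)\subseteq Y(T)$; it sends points of $X_y$ and of $F\times_k\kappa(y)$ lying over $t$ to points lying over $g\cdot t$, by $x\mapsto g\cdot x$ and $(p,t)\mapsto(g\cdot p,g\cdot t)$. An isomorphism is $G_y$-equivariant if it commutes with these actions for all $T$. For a constant group $G$ this is equivariance under the usual subgroup $\{g\in G: g\cdot y=y\}$. -/

import Mathlib

open CategoryTheory CategoryTheory.Limits CategoryTheory.MonoidalCategory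
  CategoryTheory.CartesianMonoidalCategory AlgebraicGeometry
open scoped MonObj

universe u

noncomputable section

namespace EquivariantFibration

section CartesianActions

variable {C : Type*} [Category C] [CartesianMonoidalCategory C]

/-- An action of a monoid object `G` on `X` from a family of maps `G(T) × X(T) → X(T)` on points
that is natural in `T` and satisfies the axioms of an action. -/
abbrev actionOfPoints (G : C) [MonObj G] (X : C)
    (a : ∀ {T : C}, (T ⟶ G) → (T ⟶ X) → (T ⟶ X))
    (nat : ∀ {T T' : C} (p : T' ⟶ T) (g : T ⟶ G) (x : T ⟶ X), p ≫ a g x = a (p ≫ g) (p ≫ x))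
    (one : ∀ {T : C} (x : T ⟶ X), a 1 x = x)
    (mul : ∀ {T : C} (g h : T ⟶ G) (x : T ⟶ X), a (g * h) x = a g (a h x)) :
    ModObj G X where
  smul := a (fst G X) (snd G X)
  one_smul := by
    change η[G] ▷ X ≫ a (fst G X) (snd G X) = (λ_ X).hom
    rw [nat, whiskerRight_fst, whiskerRight_snd, leftUnitor_hom,
      show fst (𝟙_ C) X ≫ η[G] = 1 by
        rw [Hom.one_def]; congr 1; exact toUnit_unique _ _, one]
  mul_smul := by
    change μ[G] ▷ X ≫ a (fst G X) (snd G X) =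
      (α_ G G X).hom ≫ G ◁ a (fst G X) (snd G X) ≫ a (fst G X) (snd G X)
    simp only [nat, whiskerRight_fst, whiskerRight_snd, whiskerLeft_fst, whiskerLeft_snd,
      associator_hom_fst, associator_hom_snd_fst, associator_hom_snd_snd]
    rw [show fst (G ⊗ G) X ≫ μ[G] =
        (fst (G ⊗ G) X ≫ fst G G) * (fst (G ⊗ G) X ≫ snd G G) by
      rw [Hom.mul_def]; congr 1; ext <;> simp, mul]

variable (G : C) [MonObj G]

/-- The diagonal action on a product: `g • (x, y) = (g • x, g • y)`. -/
instance diagonalAction (X Y : C) [ModObj G X] [ModObj G Y] : ModObj G (X ⊗ Y) :=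
  actionOfPoints G (X ⊗ Y)
    (fun g p => lift (g • (p ≫ fst X Y)) (g • (p ≫ snd X Y)))
    (fun p g x => by simp [comp_lift, ModObj.comp_smul])
    (fun x => by ext <;> simp)
    (fun g h x => by ext <;> simp [mul_smul])

/-- The action on a fibre product `X ×_Z Y` of equivariant morphisms:
`g • (x, y) = (g • x, g • y)`. -/
instance pullbackAction {X Y Z : C} [ModObj G X] [ModObj G Y] [ModObj G Z]
    (f : X ⟶ Z) (h : Y ⟶ Z) [IsModHom G f] [IsModHom G h] [HasPullback f h] :
    ModObj G (pullback f h) :=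
  actionOfPoints G (pullback f h)
    (fun g p => pullback.lift (g • (p ≫ pullback.fst f h)) (g • (p ≫ pullback.snd f h)) (by
      rw [IsModHom.map_smul, IsModHom.map_smul, Category.assoc, Category.assoc,
        pullback.condition]))
    (fun p g x => by
      apply pullback.hom_ext <;>
        simp only [Category.assoc, pullback.lift_fst, pullback.lift_snd,
          ModObj.comp_smul])
    (fun x => by
      apply pullback.hom_ext <;> simp only [pullback.lift_fst, pullback.lift_snd, one_smul])
    (fun g h x => by
      apply pullback.hom_ext <;> simp only [pullback.lift_fst, pullback.lift_snd, mul_smul])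

end CartesianActions

section Schemes

variable {k : Type u} [Field k]

/-- An algebraic `k`-variety: a separated `k`-scheme of finite type
(not necessarily reduced or irreducible). -/
structure IsVariety (X : Over (Spec (.of k))) : Prop where
  locallyOfFiniteType : LocallyOfFiniteType X.hom
  quasiCompact : QuasiCompact X.hom
  isSeparated : IsSeparated X.hom

variable (G : Over (Spec (.of k))) [GrpObj G]

/-- The orbit of a point `x` of `X`: the image under the action map `G ×_k X ⟶ X` of the set of
points of `G ×_k X` lying over `x`. -/
def orbit (X : Over (Spec (.of k))) [ModObj G X] (x : X.left) : Set X.left :=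
  (γ[G, X] : G ⊗ X ⟶ X).left '' ((snd G X).left ⁻¹' {x})

/-- An action is good if every orbit is contained in an affine open subset. -/
def IsGoodAction (X : Over (Spec (.of k))) [ModObj G X] : Prop :=
  ∀ x : X.left, ∃ U : X.left.Opens, IsAffineOpen U ∧ orbit G X x ⊆ (U : Set X.left)

/-- `Spec κ(y)` as a `k`-scheme, for a point `y` of the `k`-scheme `Y`. -/
abbrev point (Y : Over (Spec (.of k))) (y : Y.left) : Over (Spec (.of k)) :=
  Over.mk (Y.left.fromSpecResidueField y ≫ Y.hom)

/-- The canonical monomorphism `Spec κ(y) ⟶ Y` of `k`-schemes. -/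
abbrev pointι (Y : Over (Spec (.of k))) (y : Y.left) : point Y y ⟶ Y :=
  Over.homMk (Y.left.fromSpecResidueField y)

/-- The scheme-theoretic fibre `X_y = X ×_Y Spec κ(y)`. -/
abbrev fibre {X Y : Over (Spec (.of k))} (f : X ⟶ Y) (y : Y.left) : Over (Spec (.of k)) :=
  pullback f (pointι Y y)

variable {G} in
/-- Finitely many `G`-invariant locally closed subschemes of `Y` whose underlying sets form a
partition of `Y`. Invariance of the subscheme `B i` means that the action of `G` on `Y` restricts
to an action on `B i`. -/
structure InvariantStratification (Y : Over (Spec (.of k))) [ModObj G Y] where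
  n : ℕ
  B : Fin n → Over (Spec (.of k))
  emb : ∀ i, B i ⟶ Y
  immersion : ∀ i, IsImmersion (emb i).left
  action : ∀ i, ModObj G (B i)
  equivariant : ∀ i, IsModHom G (emb i)
  partition : ∀ y : Y.left, ∃! i, y ∈ Set.range (emb i).left

attribute [instance] InvariantStratification.action InvariantStratification.equivariant

/-- `f : X ⟶ Y` is a `G`-equivariant piecewise trivial fibration with fibre `F`: for the strata
`B` of a finite `G`-invariant stratification of `Y`, the preimage `X ×_Y B` is `G`-equivariantly
isomorphic to `B ×_k F` with its diagonal action, in such a way that `f` becomes the projection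
to `B`. -/
def IsPiecewiseTrivialFibrationWithFibre {X Y : Over (Spec (.of k))} [ModObj G X] [ModObj G Y]
    (f : X ⟶ Y) [IsModHom G f] (F : Over (Spec (.of k))) [ModObj G F] : Prop :=
  ∃ S : InvariantStratification (G := G) Y, ∀ i : Fin S.n,
    ∃ φ : pullback f (S.emb i) ≅ S.B i ⊗ F,
      IsModHom G φ.hom ∧ φ.hom ≫ fst (S.B i) F = pullback.snd f (S.emb i)

/-- `f` is a `G`-equivariant piecewise trivial fibration, with some variety with good `G`-action
as its fibre. -/
def IsPiecewiseTrivialFibration {X Y : Over (Spec (.of k))} [ModObj G X] [ModObj G Y]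
    (f : X ⟶ Y) [IsModHom G f] : Prop :=
  ∃ (F : Over (Spec (.of k))) (_ : ModObj G F), IsVariety F ∧ IsGoodAction G F ∧
    IsPiecewiseTrivialFibrationWithFibre G f F

/-- The `T`-points of the stabilizer `G_y` of a point `y` of `Y`. An element of `G` fixes `y` if
it carries `y` to `y`, that is, `Spec κ(y) ⊆ Y` to itself; it may act nontrivially on `κ(y)`.
In terms of `T`-points: a point `src` of `Spec κ(y)` and an element `elt` of `G` such that
`elt • src`, a priori a point of `Y`, is a point `tgt` of `Spec κ(y)` again. Such pairs are the
points of the `κ(y)`-scheme of elements of `G` over `κ(y)` fixing `y`, the preimage of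
`Spec κ(y) ⊆ Y` under the orbit map `G ×_k Spec κ(y) ⟶ Y`. If `G` is a constant group and `T` is
connected then `elt` is an element of the subgroup `{g | g • y = y}`. -/
structure Stabilizer (Y : Over (Spec (.of k))) [ModObj G Y] (y : Y.left)
    (T : Over (Spec (.of k))) where
  elt : T ⟶ G
  src : T ⟶ point Y y
  tgt : T ⟶ point Y y
  smul_src : elt • (src ≫ pointι Y y) = tgt ≫ pointι Y y

variable {G} in
/-- The action of `G_y` on the fibre `X_y` of an equivariant morphism `f : X ⟶ Y`. It sends the
points over `src` to points over `tgt`. -/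
def Stabilizer.smulFibre {X Y : Over (Spec (.of k))} [ModObj G X] [ModObj G Y] (f : X ⟶ Y)
    [IsModHom G f] {y : Y.left} {T : Over (Spec (.of k))} (g : Stabilizer G Y y T)
    (x : T ⟶ fibre f y) (hx : x ≫ pullback.snd f (pointι Y y) = g.src) : T ⟶ fibre f y :=
  pullback.lift (g.elt • (x ≫ pullback.fst f (pointι Y y))) g.tgt (by
    rw [IsModHom.map_smul, Category.assoc, pullback.condition, reassoc_of% hx, g.smul_src])

variable {G} in
/-- The diagonal action of `G_y` on `Spec κ(y) ×_k F`. It sends the point `(src, p)` to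
`(tgt, elt • p)`. -/
def Stabilizer.smulProd {Y F : Over (Spec (.of k))} [ModObj G Y] [ModObj G F]
    {y : Y.left} {T : Over (Spec (.of k))} (g : Stabilizer G Y y T)
    (p : T ⟶ point Y y ⊗ F) : T ⟶ point Y y ⊗ F :=
  lift g.tgt (g.elt • (p ≫ snd (point Y y) F))

/-- There is a `G_y`-equivariant isomorphism of `κ(y)`-schemes `X_y ≅ F ×_k κ(y)`. -/
def FibreIsTrivial {X Y : Over (Spec (.of k))} [ModObj G X] [ModObj G Y] (f : X ⟶ Y)
    [IsModHom G f] (F : Over (Spec (.of k))) [ModObj G F] (y : Y.left) : Prop :=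
  ∃ φ : fibre f y ≅ point Y y ⊗ F,
    φ.hom ≫ fst (point Y y) F = pullback.snd f (pointι Y y) ∧
    ∀ (T : Over (Spec (.of k))) (g : Stabilizer G Y y T) (x : T ⟶ fibre f y)
      (hx : x ≫ pullback.snd f (pointι Y y) = g.src),
      g.smulFibre f x hx ≫ φ.hom = g.smulProd (x ≫ φ.hom)

end Schemes

end EquivariantFibration

end

/-!
An equivariant isomorphism of `X ×_Y B` with `B × F` restricts to the points of the strata `B`, so
only the construction of a stratification from trivialisations over the points needs an argument.

The common notion is that of a trivialisation of `f` along a morphism `i : W ⟶ Y` which need not be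
equivariant: an isomorphism of `X ×_Y W` with `W × F` over `W` which commutes with those `g ∈ G`
that carry one point of `W` to another (`TrivialAlong`). For `W = Spec κ(y)` this is equivariance
under the stabiliser of `y` (`fibreIsTrivial_iff`), and for an invariant subscheme it is
equivariance under `G` (`trivialAlong_iff_of_isModHom`).

Given a nonempty closed invariant subset `S` of `Y`, let `y` be the generic point of an irreducible
component of `S`, and let `C` be the closure of `y` with its reduced structure. Since `Spec κ(y)` is
the limit of the affine open neighbourhoods of the generic point of `C`, the trivialisation over `y`
extends to a trivialisation along an open piece `W` of `C` (`exists_trivialAlong_opensι`); that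
its equivariance extends as well uses that `G` carries `y` to no other point of `C`, because `G` is
finite (`eq_of_specializes_of_mem_orbit`).

The stratum is the scheme-theoretic image `Z` of the orbit map `G × W ⟶ Y`. Once `W` is small, this
map is faithfully flat onto `Z` (`exists_immersion_orbitMap`). Namely, `(G × W) ×_Z (G × W)` is
pulled back from the scheme of the `(g, c, c')` with `g ∈ G` and `c, c' ∈ C` such that `g • c = c'`,
which is finite over `C` by its last projection and hence flat over an open piece of `C`
(`exists_opens_flat`). So the finite morphism `G × W ⟶ Z` is flat after base change along itself,
and it is injective on functions. This forces it to be flat (`flat_of_isPullback_self`), since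
flatness of finite modules descends along finite injective ring extensions, even though these need
not be flat (`flat_of_flat_baseChange`).

A faithfully flat morphism is a universally effective epimorphism, so the action of `G` and the
trivialisation descend from `G × W` to `Z`, as `x ↦ g • φ (g⁻¹ • x)` for `x` over `g • w`
(`exists_action_of_effectiveEpi`, `TrivialAlong.descend`). Topologically `Z` is a nonempty open
invariant subset of `S` (`exists_stratum`), and Noetherian induction on `S` finishes the proof
(`exists_stratification_of_isClosed`).
-/

namespace EquivariantFibration

/-! ### Equivariant morphisms -/

section Actions

variable {C : Type*} [Category C] [CartesianMonoidalCategory C] {G : C} [MonObj G]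

/-- Equivariance of a morphism may be checked on points. -/
lemma _root_.CategoryTheory.IsModHom.of_points {X Y : C} [ModObj G X] [ModObj G Y] (f : X ⟶ Y)
    (h : ∀ {T : C} (g : T ⟶ G) (x : T ⟶ X), (g • x) ≫ f = g • (x ≫ f)) : IsModHom G f where
  smul_hom := by
    have := h (fst G X) (snd G X)
    simp only [Hom.smul_def, lift_fst_snd, Category.id_comp] at this
    rw [this]
    change _ = (G ◁ f) ≫ _
    congr 1
    ext <;> simp

variable {X Y Z : C} [ModObj G X] [ModObj G Y] [ModObj G Z]

instance : IsModHom G (fst X Y) where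
  smul_hom := by
    change lift (fst G (X ⊗ Y) • (snd G (X ⊗ Y) ≫ fst X Y))
      (fst G (X ⊗ Y) • (snd G (X ⊗ Y) ≫ snd X Y)) ≫ fst X Y = (G ◁ fst X Y) ≫ _
    rw [lift_fst, Hom.smul_def]
    congr 1
    ext <;> simp

instance : IsModHom G (snd X Y) where
  smul_hom := by
    change lift (fst G (X ⊗ Y) • (snd G (X ⊗ Y) ≫ fst X Y))
      (fst G (X ⊗ Y) • (snd G (X ⊗ Y) ≫ snd X Y)) ≫ snd X Y = (G ◁ snd X Y) ≫ _
    rw [lift_snd, Hom.smul_def]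
    congr 1
    ext <;> simp

variable (f : X ⟶ Z) (h : Y ⟶ Z) [IsModHom G f] [IsModHom G h] [HasPullback f h]

instance : IsModHom G (pullback.fst f h) where
  smul_hom := by
    change pullback.lift (fst G (pullback f h) • (snd G (pullback f h) ≫ pullback.fst f h))
      (fst G (pullback f h) • (snd G (pullback f h) ≫ pullback.snd f h)) _ ≫ pullback.fst f h =
      (G ◁ pullback.fst f h) ≫ _
    rw [pullback.lift_fst, Hom.smul_def]
    congr 1
    ext <;> simp

instance : IsModHom G (pullback.snd f h) where
  smul_hom := by
    change pullback.lift (fst G (pullback f h) • (snd G (pullback f h) ≫ pullback.fst f h))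
      (fst G (pullback f h) • (snd G (pullback f h) ≫ pullback.snd f h)) _ ≫ pullback.snd f h =
      (G ◁ pullback.snd f h) ≫ _
    rw [pullback.lift_snd, Hom.smul_def]
    congr 1
    ext <;> simp

end Actions

/-! ### Trivialisations along arbitrary morphisms -/

section Trivialisations

variable {C : Type*} [Category C] [CartesianMonoidalCategory C] [HasPullbacks C]

/-- An equivariant trivialisation of `f : X ⟶ Y` with fibre `F` along a morphism `i : W ⟶ Y` which
need not be equivariant: an isomorphism `X ×_Y W ≅ W × F` over `W` such that
`φ (g • x, w') = g • φ (x, w)` in `F` whenever `(x, w)` and `(g • x, w')` are points of `X ×_Y W`.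
This is equivariance for the groupoid on `W` induced by the action groupoid of `Y`. -/
def TrivialAlong (G : C) [MonObj G] {X Y : C} [ModObj G X] (f : X ⟶ Y)
    (F : C) [ModObj G F] {W : C} (i : W ⟶ Y) : Prop :=
  ∃ φ : pullback f i ≅ W ⊗ F, φ.hom ≫ fst W F = pullback.snd f i ∧
    ∀ (T : C) (g : T ⟶ G) (p q : T ⟶ pullback f i),
      g • (p ≫ pullback.fst f i) = q ≫ pullback.fst f i →
        q ≫ φ.hom ≫ snd W F = g • (p ≫ φ.hom ≫ snd W F)

variable {G : C} [MonObj G] {X Y F : C} [ModObj G X] [ModObj G F] {f : X ⟶ Y}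

/-- A trivialisation given by the two components `α : X ×_Y W ⟶ F` and `β : W × F ⟶ X` of the
isomorphism and its inverse. -/
lemma TrivialAlong.of_components {W : C} {i : W ⟶ Y} (α : pullback f i ⟶ F) (β : W ⊗ F ⟶ X)
    (hβ : β ≫ f = fst W F ≫ i)
    (hβα : pullback.lift β (fst W F) hβ ≫ α = snd W F)
    (hαβ : lift (pullback.snd f i) α ≫ β = pullback.fst f i)
    (hα : ∀ (T : C) (g : T ⟶ G) (p q : T ⟶ pullback f i),
      g • (p ≫ pullback.fst f i) = q ≫ pullback.fst f i → q ≫ α = g • (p ≫ α)) :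
    TrivialAlong G f F i := by
  refine ⟨⟨lift (pullback.snd f i) α, pullback.lift β (fst W F) hβ, ?_, ?_⟩, ?_, ?_⟩
  · apply pullback.hom_ext <;> simp [hαβ, pullback.lift_fst, pullback.lift_snd]
  · ext <;> simp [hβα, pullback.lift_snd]
  · simp
  · intro T g p q h
    simpa using hα T g p q h

lemma TrivialAlong.comp {W W' : C} {i : W ⟶ Y} (h : TrivialAlong G f F i) (j : W' ⟶ W) :
    TrivialAlong G f F (j ≫ i) := by
  obtain ⟨φ, hφ, hG⟩ := h
  have hφ' : φ.inv ≫ pullback.snd f i = fst W F := by rw [← hφ]; simp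
  let r : pullback f (j ≫ i) ⟶ pullback f i :=
    pullback.lift (pullback.fst _ _) (pullback.snd _ _ ≫ j)
      (by rw [Category.assoc, pullback.condition])
  refine .of_components (r ≫ φ.hom ≫ snd W F) ((j ▷ F) ≫ φ.inv ≫ pullback.fst f i) ?_ ?_ ?_ ?_
  · rw [Category.assoc, Category.assoc, pullback.condition, reassoc_of% hφ']
    simp
  · have : pullback.lift ((j ▷ F) ≫ φ.inv ≫ pullback.fst f i) (fst W' F) (by
        rw [Category.assoc, Category.assoc, pullback.condition, reassoc_of% hφ']
        simp) ≫ r = (j ▷ F) ≫ φ.inv := by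
      apply pullback.hom_ext
      · simp [r, pullback.lift_fst]
      · simp [r, hφ', pullback.lift_snd, pullback.lift_snd_assoc]
    rw [reassoc_of% this]
    simp
  · have : lift (pullback.snd f (j ≫ i)) (r ≫ φ.hom ≫ snd W F) ≫ (j ▷ F) = r ≫ φ.hom := by
      ext
      · simp [hφ, r, pullback.lift_snd]
      · simp
    rw [reassoc_of% this]
    simp [r, pullback.lift_fst]
  · intro T g p q h
    have := hG T g (p ≫ r) (q ≫ r) (by simpa [r, pullback.lift_fst] using h)
    simpa using this

/-- Over an equivariant monomorphism, a trivialisation is the same as an equivariant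
isomorphism. -/
lemma trivialAlong_iff_of_isModHom [ModObj G Y] [IsModHom G f] {B : C} [ModObj G B] (i : B ⟶ Y)
    [Mono i] [IsModHom G i] :
    TrivialAlong G f F i ↔ ∃ φ : pullback f i ≅ B ⊗ F,
      IsModHom G φ.hom ∧ φ.hom ≫ fst B F = pullback.snd f i := by
  constructor
  · rintro ⟨φ, hφ, h⟩
    refine ⟨φ, .of_points _ fun {T} g p ↦ ?_, hφ⟩
    have hq : (g • p) ≫ pullback.snd f i = g • (p ≫ pullback.snd f i) := IsModHom.map_smul _ g p
    apply CartesianMonoidalCategory.hom_ext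
    · rw [Category.assoc, hφ, hq, IsModHom.map_smul, Category.assoc, hφ]
    · rw [Category.assoc, h T g p (g • p) (by rw [IsModHom.map_smul]), IsModHom.map_smul,
        Category.assoc]
  · rintro ⟨φ, _, h⟩
    refine ⟨φ, h, fun T g p q hq ↦ ?_⟩
    have : q = g • p := by
      apply pullback.hom_ext
      · rw [← hq, IsModHom.map_smul]
      · rw [← cancel_mono i, Category.assoc, ← pullback.condition, IsModHom.map_smul,
          IsModHom.map_smul, Category.assoc, ← pullback.condition, ← reassoc_of% hq,
          IsModHom.map_smul, Category.assoc]
    rw [this, ← Category.assoc, IsModHom.map_smul, IsModHom.map_smul, Category.assoc]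

end Trivialisations

/-! ### Descent along orbit maps -/

section Descent

lemma smul_orbit {C : Type*} [Category C] [CartesianMonoidalCategory C] {G : C} [MonObj G]
    {Y W Z : C} [ModObj G Y] {i : W ⟶ Y} {π : G ⊗ W ⟶ Z} {j : Z ⟶ Y}
    (hπ : π ≫ j = fst G W • (snd G W ≫ i)) {T : C} (u : T ⟶ G ⊗ W) :
    u ≫ π ≫ j = (u ≫ fst G W) • ((u ≫ snd G W) ≫ i) := by
  rw [hπ, ModObj.comp_smul, Category.assoc]

variable {C : Type*} [Category C] [HasPullbacks C]

/-- Morphisms out of `P` over `Z` may be constructed on those points of `P` whose image in `Z`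
lifts to `U`, provided the result does not depend on the lift. -/
lemma exists_hom_of_effectiveEpi {U Z P Q : C} (π : U ⟶ Z) (z : P ⟶ Z)
    [EffectiveEpi (pullback.fst z π)]
    (E : ∀ {T : C} (p : T ⟶ P) (u : T ⟶ U), p ≫ z = u ≫ π → (T ⟶ Q))
    (nat : ∀ {T T' : C} (t : T' ⟶ T) (p : T ⟶ P) (u : T ⟶ U) (h : p ≫ z = u ≫ π),
      t ≫ E p u h = E (t ≫ p) (t ≫ u) (by simp [h]))
    (indep : ∀ {T : C} (p : T ⟶ P) (u u' : T ⟶ U) (h : p ≫ z = u ≫ π) (h' : p ≫ z = u' ≫ π),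
      E p u h = E p u' h') :
    ∃ Θ : P ⟶ Q, ∀ {T : C} (p : T ⟶ P) (u : T ⟶ U) (h : p ≫ z = u ≫ π), p ≫ Θ = E p u h := by
  refine ⟨EffectiveEpi.desc (pullback.fst z π)
    (E (pullback.fst z π) (pullback.snd z π) pullback.condition) fun {T} t t' ht ↦ ?_,
    fun {T} p u h ↦ ?_⟩
  · simp only [nat, ht]
    exact indep _ _ _ _ _
  · have := pullback.lift p u h ≫= EffectiveEpi.fac (pullback.fst z π)
      (E (pullback.fst z π) (pullback.snd z π) pullback.condition) fun {T} t t' ht ↦ (by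
        simp only [nat, ht]
        exact indep _ _ _ _ _)
    simpa only [nat, pullback.lift_fst_assoc, pullback.lift_fst, pullback.lift_snd] using this

lemma hom_ext_of_effectiveEpi {U Z P Q : C} (π : U ⟶ Z) (z : P ⟶ Z)
    [EffectiveEpi (pullback.fst z π)] {a b : P ⟶ Q}
    (h : ∀ {T : C} (p : T ⟶ P) (u : T ⟶ U), p ≫ z = u ≫ π → p ≫ a = p ≫ b) : a = b :=
  (cancel_epi (pullback.fst z π)).mp (h _ _ pullback.condition)

variable [CartesianMonoidalCategory C] {G : C} [GrpObj G] {X Y F : C} [ModObj G X] [ModObj G Y]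
  [ModObj G F] {W Z : C} {i : W ⟶ Y} {π : G ⊗ W ⟶ Z} {j : Z ⟶ Y} [Mono j]

/-- The image `Z` of the orbit map `G × W ⟶ Y` of a morphism `W ⟶ Y` is invariant: on a point of
`Z` which is the image of `(h, w)`, an element `g` acts by sending it to the image of `(g * h, w)`.
-/
lemma exists_action_of_effectiveEpi (hπ : π ≫ j = fst G W • (snd G W ≫ i))
    [EffectiveEpi (pullback.fst (snd G Z) π)] :
    ∃ _ : ModObj G Z, IsModHom G j := by
  obtain ⟨a, ha⟩ := exists_hom_of_effectiveEpi π (snd G Z)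
    (fun p u _ ↦ lift ((p ≫ fst G Z) * (u ≫ fst G W)) (u ≫ snd G W) ≫ π)
    (fun t p u h ↦ by simp only [comp_lift_assoc, MonObj.comp_mul, Category.assoc])
    (fun p u u' h h' ↦ by
      rw [← cancel_mono j, Category.assoc, Category.assoc, smul_orbit hπ, smul_orbit hπ]
      simp only [lift_fst, lift_snd, mul_smul]
      rw [← smul_orbit hπ, ← smul_orbit hπ, ← reassoc_of% h, ← reassoc_of% h'])
  have haj : a ≫ j = fst G Z • (snd G Z ≫ j) := by
    refine hom_ext_of_effectiveEpi π (snd G Z) fun p u h ↦ ?_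
    rw [reassoc_of% ha p u h, smul_orbit hπ, ModObj.comp_smul]
    simp only [lift_fst, lift_snd, mul_smul]
    rw [← smul_orbit hπ, reassoc_of% h]
  have haj' {T : C} (g : T ⟶ G) (z : T ⟶ Z) : (lift g z ≫ a) ≫ j = g • (z ≫ j) := by
    rw [Category.assoc, haj, ModObj.comp_smul]
    simp
  let _ : ModObj G Z := actionOfPoints G Z (fun g z ↦ lift g z ≫ a)
    (fun p g x ↦ by simp [comp_lift_assoc]) (fun x ↦ by rw [← cancel_mono j, haj', one_smul])
    (fun g h x ↦ by rw [← cancel_mono j, haj', haj', haj', mul_smul])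
  refine ⟨inferInstance, ⟨?_⟩⟩
  change (lift (fst G Z) (snd G Z) ≫ a) ≫ j = (G ◁ j) ≫ _
  rw [haj', Hom.smul_def]
  congr 1
  ext <;> simp

variable {f : X ⟶ Y} [IsModHom G f]

/-- Descent of trivialisations along the orbit map `π : G × W ⟶ Z`: the trivialisation over `W`
is spread to `Z` by `x ↦ g • φ (g⁻¹ • x)` for `x` over `g • w`. The choice of `(g, w)` does not
matter because `φ` is equivariant for the groupoid on `W` induced by the action groupoid. -/
theorem TrivialAlong.descend (hπ : π ≫ j = fst G W • (snd G W ≫ i))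
    (hepi : ∀ {P : C} (z : P ⟶ Z), EffectiveEpi (pullback.fst z π))
    (h : TrivialAlong G f F i) : TrivialAlong G f F j := by
  obtain ⟨φ, hφ, hG⟩ := h
  have hφ' : φ.inv ≫ pullback.snd f i = fst W F := by rw [← hφ]; simp
  let α : pullback f i ⟶ F := φ.hom ≫ snd W F
  let β : W ⊗ F ⟶ X := φ.inv ≫ pullback.fst f i
  have hβ : β ≫ f = fst W F ≫ i := by
    rw [Category.assoc, pullback.condition, reassoc_of% hφ']
  have hα {T : C} (g : T ⟶ G) (p q : T ⟶ pullback f i)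
      (h : g • (p ≫ pullback.fst f i) = q ≫ pullback.fst f i) : q ≫ α = g • (p ≫ α) :=
    hG T g p q h
  have hβα {T : C} (w : T ⟶ W) (q : T ⟶ F) (h) :
      pullback.lift (lift w q ≫ β) w h ≫ α = q := by
    have : pullback.lift (lift w q ≫ β) w h = lift w q ≫ φ.inv := by
      apply pullback.hom_ext
      · simp [β, pullback.lift_fst]
      · simp [hφ', pullback.lift_snd]
    simp [this, α]
  have hαβ {T : C} (p : T ⟶ pullback f i) :
      lift (p ≫ pullback.snd f i) (p ≫ α) ≫ β = p ≫ pullback.fst f i := by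
    have : lift (p ≫ pullback.snd f i) (p ≫ α) = p ≫ φ.hom := by
      ext <;> simp [α, hφ]
    simp [this, β]
  have hβ' {T : C} (w : T ⟶ W) (q : T ⟶ F) : (lift w q ≫ β) ≫ f = w ≫ i := by
    rw [Category.assoc, hβ, lift_fst_assoc]
  have hβG {T : C} (g : T ⟶ G) (w w' : T ⟶ W) (q : T ⟶ F) (h : g • (w ≫ i) = w' ≫ i) :
      lift w' (g • q) ≫ β = g • (lift w q ≫ β) := by
    have h' : (g • (lift w q ≫ β)) ≫ f = w' ≫ i := by rw [IsModHom.map_smul, hβ', h]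
    have := hα g (pullback.lift _ w (hβ' w q)) (pullback.lift (g • (lift w q ≫ β)) w' h')
      (by rw [pullback.lift_fst, pullback.lift_fst])
    rw [hβα] at this
    rw [← this]
    have := hαβ (pullback.lift (g • (lift w q ≫ β)) w' h')
    simpa only [pullback.lift_fst, pullback.lift_snd] using this
  -- If `p` lies over `u = (g, w)`, then `g⁻¹ • p` lies over `w`, where `φ` applies.
  have hx {T : C} (p : T ⟶ pullback f j) (u : T ⟶ G ⊗ W) (h : p ≫ pullback.snd f j = u ≫ π) :
      ((u ≫ fst G W)⁻¹ • (p ≫ pullback.fst f j)) ≫ f = (u ≫ snd G W) ≫ i := by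
    rw [IsModHom.map_smul, Category.assoc, pullback.condition, reassoc_of% h, smul_orbit hπ,
      inv_smul_smul]
  obtain ⟨A, hA⟩ := exists_hom_of_effectiveEpi (Q := F) π (pullback.snd f j)
    (fun p u h ↦ (u ≫ fst G W) • (pullback.lift _ _ (hx p u h) ≫ α))
    (fun t p u h ↦ by
      rw [ModObj.comp_smul]
      congr 1
      · simp
      · rw [← Category.assoc]
        congr 1
        apply pullback.hom_ext
        · simp [pullback.lift_fst, ModObj.comp_smul, GrpObj.comp_inv]
        · simp [pullback.lift_snd])
    (fun p u u' h h' ↦ by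
      rw [hα ((u ≫ fst G W)⁻¹ * (u' ≫ fst G W)) (pullback.lift _ _ (hx p u' h'))
        (pullback.lift _ _ (hx p u h)), smul_smul, mul_inv_cancel_left]
      rw [pullback.lift_fst, pullback.lift_fst, smul_smul, mul_assoc, mul_inv_cancel, mul_one])
  obtain ⟨B, hB⟩ := exists_hom_of_effectiveEpi (Q := X) π (fst Z F)
    (fun p u h ↦ (u ≫ fst G W) • (lift (u ≫ snd G W) ((u ≫ fst G W)⁻¹ • (p ≫ snd Z F)) ≫ β))
    (fun t p u h ↦ by
      simp [ModObj.comp_smul, GrpObj.comp_inv, comp_lift_assoc])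
    (fun p u u' h h' ↦ by
      have := hβG ((u ≫ fst G W)⁻¹ * (u' ≫ fst G W)) (u' ≫ snd G W) (u ≫ snd G W)
        ((u' ≫ fst G W)⁻¹ • (p ≫ snd Z F)) (by
          rw [mul_smul, inv_smul_eq_iff, ← smul_orbit hπ,
            ← smul_orbit hπ, ← reassoc_of% h, ← reassoc_of% h'])
      rw [smul_smul, mul_assoc, mul_inv_cancel, mul_one] at this
      rw [this, smul_smul, mul_inv_cancel_left])
  have hBf : B ≫ f = fst Z F ≫ j := by
    refine hom_ext_of_effectiveEpi π (fst Z F) fun p u h ↦ ?_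
    rw [reassoc_of% hB p u h, reassoc_of% h, IsModHom.map_smul, hβ', smul_orbit hπ]
  refine .of_components A B hBf ?_ ?_ ?_
  · refine hom_ext_of_effectiveEpi π (fst Z F) fun p u h ↦ ?_
    have h' : (p ≫ pullback.lift B (fst Z F) hBf) ≫ pullback.snd f j = u ≫ π := by
      rw [Category.assoc, pullback.lift_snd, h]
    rw [← Category.assoc, hA _ u h', ← eq_inv_smul_iff]
    rw [← hβα (u ≫ snd G W) ((u ≫ fst G W)⁻¹ • (p ≫ snd Z F)) (hβ' _ _)]
    congr 1
    apply pullback.hom_ext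
    · simp only [pullback.lift_fst, Category.assoc, hB p u h, inv_smul_smul]
    · simp only [pullback.lift_snd]
  · refine hom_ext_of_effectiveEpi π (pullback.snd f j) fun p u h ↦ ?_
    have h' : (p ≫ lift (pullback.snd f j) A) ≫ fst Z F = u ≫ π := by
      rw [Category.assoc, lift_fst, h]
    rw [← Category.assoc, hB _ u h', ← eq_inv_smul_iff, Category.assoc, lift_snd, hA p u h,
      inv_smul_smul]
    have := hαβ (pullback.lift _ _ (hx p u h))
    simpa only [pullback.lift_fst, pullback.lift_snd] using this
  · intro T g p q hpq
    refine hom_ext_of_effectiveEpi π (p ≫ pullback.snd f j) fun t u h ↦ ?_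
    have hq : (t ≫ q) ≫ pullback.snd f j =
        lift ((t ≫ g) * (u ≫ fst G W)) (u ≫ snd G W) ≫ π := by
      rw [← cancel_mono j, Category.assoc, Category.assoc, Category.assoc, ← pullback.condition,
        ← reassoc_of% hpq, smul_orbit hπ, IsModHom.map_smul, Category.assoc, pullback.condition,
        ModObj.comp_smul]
      simp only [lift_fst, lift_snd, mul_smul]
      rw [← smul_orbit hπ, ← reassoc_of% h]
    rw [← Category.assoc, hA _ _ hq, ModObj.comp_smul, ← Category.assoc t p,
      hA (t ≫ p) u (by rw [Category.assoc, h]), smul_smul]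
    congr 1
    · rw [lift_fst]
    congr 1
    apply pullback.hom_ext
    · simp only [pullback.lift_fst, Category.assoc, lift_fst, ← hpq, ModObj.comp_smul, mul_inv_rev,
        mul_smul, inv_smul_smul]
    · simp only [pullback.lift_snd, lift_snd]

end Descent

/-! ### Descent of flatness along finite dominant morphisms -/

section FlatnessDescent

open scoped TensorProduct

/-- Over a local ring `A`, flatness of a finite module descends along a finite injective algebra
`B`: a minimal presentation `A ^ r → N` becomes an isomorphism over `B`, since `B ⊗ N` has rank `r`
at every maximal ideal of `B`, and `A ^ r → B ^ r` is injective. -/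
lemma flat_of_flat_baseChange_of_isLocalRing {A B N : Type u} [CommRing A] [IsLocalRing A]
    [CommRing B] [Algebra A B] [Module.Finite A B] (hAB : Function.Injective (algebraMap A B))
    [AddCommGroup N] [Module A N] [Module.Finite A N] [Module.Flat B (B ⊗[A] N)] :
    Module.Flat A N := by
  let κ := IsLocalRing.ResidueField A
  let b := Module.finBasis κ (κ ⊗[A] N)
  choose v hv using fun i ↦ TensorProduct.mk_surjective A N κ Ideal.Quotient.mk_surjective (b i)
  let φ : (Fin (Module.finrank κ (κ ⊗[A] N)) → A) →ₗ[A] N := Fintype.linearCombination A v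
  have hφ : Function.Surjective φ := by
    rw [← LinearMap.range_eq_top, Fintype.range_linearCombination]
    exact IsLocalRing.span_eq_top_of_tmul_eq_basis v b hv
  have hbij : Function.Bijective (φ.baseChange B) := by
    refine Module.bijective_of_surjective_of_rankAtStalk_eq (LinearMap.lTensor_surjective B hφ)
      fun n hn ↦ ?_
    have hker : ∀ a ∈ IsLocalRing.maximalIdeal A, algebraMap A n.ResidueField a = 0 := by
      intro a ha
      have : n.comap (algebraMap A B) = IsLocalRing.maximalIdeal A :=
        IsLocalRing.eq_maximalIdeal (Ideal.isMaximal_comap_of_isIntegral_of_isMaximal n)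
      rw [IsScalarTower.algebraMap_apply A B, Ideal.algebraMap_residueField_eq_zero]
      rwa [← this] at ha
    let : Algebra κ n.ResidueField :=
      (Ideal.Quotient.lift (IsLocalRing.maximalIdeal A) (algebraMap A n.ResidueField)
        hker).toAlgebra
    have : IsScalarTower A κ n.ResidueField := .of_algebraMap_eq fun a ↦ rfl
    rw [Module.rankAtStalk_eq, Module.rankAtStalk_eq]
    let e (M : Type u) [AddCommGroup M] [Module A M] :
        n.ResidueField ⊗[B] (B ⊗[A] M) ≃ₗ[n.ResidueField]
          n.ResidueField ⊗[κ] (κ ⊗[A] M) :=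
      TensorProduct.AlgebraTensorModule.cancelBaseChange A B _ _ M ≪≫ₗ
        (TensorProduct.AlgebraTensorModule.cancelBaseChange A κ _ _ M).symm
    refine ((e _).finrank_eq.trans ?_).trans (e N).finrank_eq.symm
    refine Eq.trans ?_ (Module.finrank_baseChange (S := κ)).symm
    rw [Module.finrank_baseChange, Module.finrank_baseChange, Module.finrank_fin_fun]
  have hinj : Function.Injective φ := by
    rw [← LinearMap.ker_eq_bot, LinearMap.ker_eq_bot']
    intro x hx
    have h1 : (1 : B) ⊗ₜ[A] x = 0 := by
      apply hbij.1
      simp [hx]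
    have h2 := congrArg (TensorProduct.piScalarRight A A B _) h1
    ext i
    have h3 := congrFun h2 i
    apply hAB
    simpa [Algebra.algebraMap_eq_smul_one] using h3
  exact Module.Flat.of_linearEquiv (LinearEquiv.ofBijective φ ⟨hinj, hφ⟩).symm

/-- Flatness of a finite module descends along a finite injective algebra. -/
lemma flat_of_flat_baseChange {A B N : Type u} [CommRing A]
    [CommRing B] [Algebra A B] [Module.Finite A B] (hAB : Function.Injective (algebraMap A B))
    [AddCommGroup N] [Module A N] [Module.Finite A N] [Module.Flat B (B ⊗[A] N)] :
    Module.Flat A N := by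
  refine Module.flat_of_localized_maximal _ fun p _ ↦ ?_
  let A' := Localization.AtPrime p
  let B' := B ⊗[A] A'
  let : Algebra A' B' := Algebra.TensorProduct.rightAlgebra
  have halg (a : A') : algebraMap A' B' a = 1 ⊗ₜ a := rfl
  let c : A' ⊗[A] B ≃ₗ[A'] B' :=
    { TensorProduct.comm A A' B with
      map_smul' := fun a x ↦ by
        induction x with
        | zero => simp
        | add x y hx hy => simp_all
        | tmul x b =>
          rw [Algebra.smul_def (A := B'), halg]
          simp [TensorProduct.smul_tmul', B'] }
  have : Module.Finite A' B' := .equiv c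
  have hAB' : Function.Injective (algebraMap A' B') := by
    have := Module.Flat.rTensor_preserves_injective_linearMap (M := A') (Algebra.linearMap A B) hAB
    convert this.comp (TensorProduct.lid A A').symm.injective
    ext x
    simp [halg]
  let e : B' ⊗[A'] (A' ⊗[A] N) ≃ₗ[B'] B' ⊗[B] (B ⊗[A] N) :=
    TensorProduct.AlgebraTensorModule.cancelBaseChange A A' B' B' N ≪≫ₗ
      (TensorProduct.AlgebraTensorModule.cancelBaseChange A B B' B' N).symm
  have : Module.Flat B' (B' ⊗[A'] (A' ⊗[A] N)) := .of_linearEquiv e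
  have : Module.Flat A' (A' ⊗[A] N) := flat_of_flat_baseChange_of_isLocalRing hAB'
  have : Module.Flat A (A' ⊗[A] N) := .trans A A' _
  exact .of_linearEquiv ((LocalizedModule.equivTensorProduct p.primeCompl N).restrictScalars A)

instance : IsZariskiLocalAtTarget (@Flat.{u}) :=
  HasRingHomProperty.instIsZariskiLocalAtTarget (P := @Flat.{u})

instance : MorphismProperty.RespectsIso (@Flat.{u}) :=
  MorphismProperty.IsStableUnderBaseChange.respectsIso (P := @Flat.{u})

lemma isSchemeTheoreticallyDominant_toImage {X Y : Scheme.{u}} (f : X ⟶ Y) [QuasiCompact f] :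
    IsSchemeTheoreticallyDominant f.toImage := by
  refine ⟨Scheme.IdealSheafData.ext_of_iSup_eq_top
    (fun U : Y.affineOpens ↦ ⟨f.imageι ⁻¹ᵁ U.1, U.2.preimage f.imageι⟩) ?_ fun U ↦ ?_⟩
  · rw [← Scheme.Hom.preimage_iSup, iSup_affineOpens_eq_top]
    rfl
  · rw [Scheme.Hom.ker_apply, Scheme.IdealSheafData.ideal_bot]
    exact (RingHom.injective_iff_ker_eq_bot _).mp (f.toImage_app_injective U)

/-- A finite scheme-theoretically dominant morphism which becomes flat after base change along
itself is flat. -/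
theorem flat_of_isPullback_self {P R Z : Scheme.{u}} {π : P ⟶ Z} {a b : R ⟶ P}
    (h : IsPullback a b π π) [IsFinite π] [IsSchemeTheoreticallyDominant π] [Flat b] : Flat π := by
  wlog hZ : ∃ A, Z = Spec A generalizing P R Z with H
  · rw [IsZariskiLocalAtTarget.iff_of_openCover (P := @Flat) Z.affineCover]
    intro i
    let g := Z.affineCover.f i
    have h1 : IsPullback (pullback.fst (pullback.snd π g) (pullback.snd π g) ≫ pullback.fst π g)
        (pullback.snd (pullback.snd π g) (pullback.snd π g)) π (pullback.fst π g ≫ π) := by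
      rw [pullback.condition]
      exact ((IsPullback.of_hasPullback (pullback.snd π g) (pullback.snd π g)).flip.paste_vert
        (IsPullback.of_hasPullback π g).flip).flip
    have h2 := IsPullback.of_right (h₁₁ := h.lift _ _ (h1.w.trans (Category.assoc _ _ _).symm))
      (by simpa using h1) (by simp) h
    have : Flat (pullback.snd (pullback.snd π g) (pullback.snd π g)) :=
      MorphismProperty.of_isPullback h2 ‹_›
    change Flat (pullback.snd π g)
    exact H (.of_hasPullback (pullback.snd π g) (pullback.snd π g)) ⟨_, rfl⟩
  obtain ⟨A, rfl⟩ := hZ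
  wlog hP : ∃ B, P = Spec B generalizing P R with H
  · have : IsAffine P := isAffine_of_isAffineHom π
    rw [← MorphismProperty.cancel_left_of_respectsIso @Flat.{u} P.isoSpec.inv]
    have : IsSchemeTheoreticallyDominant (P.isoSpec.inv ≫ π) := inferInstance
    refine H (a := a ≫ P.isoSpec.hom) (b := b ≫ P.isoSpec.hom) ?_ ⟨_, rfl⟩
    exact h.of_iso (Iso.refl _) P.isoSpec P.isoSpec (Iso.refl _) (by simp) (by simp) (by simp)
      (by simp)
  obtain ⟨B, rfl⟩ := hP
  obtain ⟨φ, rfl⟩ := Spec.map_surjective π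
  rw [IsFinite.SpecMap_iff] at *
  have hinj : Function.Injective φ.hom := by
    have h1 : φ = (Scheme.ΓSpecIso A).inv ≫ (Spec.map φ).appTop ≫ (Scheme.ΓSpecIso B).hom := by
      rw [Scheme.ΓSpecIso_naturality, Iso.inv_hom_id_assoc]
    rw [h1]
    exact ((Scheme.ΓSpecIso B).commRingCatIsoToRingEquiv.injective.comp
      ((Spec.map φ).app_injective ⊤)).comp
      (Scheme.ΓSpecIso A).symm.commRingCatIsoToRingEquiv.injective
  algebraize [φ.hom]
  have h2 := (isPullback_SpecMap_of_isPushout _ _ _ _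
    (CommRingCat.isPushout_tensorProduct A B B)).flip
  have h3 : Flat (Spec.map (CommRingCat.ofHom
      (Algebra.TensorProduct.includeLeftRingHom : B →+* B ⊗[A] B))) := by
    have := IsPullback.isoIsPullback_inv_snd _ _ h h2
    rw [← this]
    infer_instance
  rw [Flat.SpecMap_iff] at h3 ⊢
  have : Module.Flat B (B ⊗[A] B) := (RingHom.flat_algebraMap_iff).mp h3
  exact flat_of_flat_baseChange (B := B) hinj

end FlatnessDescent

/-! ### Generic flatness of finite morphisms -/

section GenericFlatness

/-- Algebraic form of generic flatness: a finite algebra over a domain becomes flat, even free,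
after inverting one nonzero element. -/
lemma exists_flat_awayMap {D B : Type u} [CommRing D] [IsDomain D] [IsNoetherianRing D]
    [CommRing B] (φ : D →+* B) (hφ : φ.Finite) :
    ∃ d : D, d ≠ 0 ∧ ∀ (D' B' : Type u) [CommRing D'] [CommRing B'] [Algebra D D'] [Algebra B B']
      [IsLocalization.Away d D'] [IsLocalization.Away (φ d) B'],
      (IsLocalization.Away.map D' B' φ d).Flat := by
  algebraize [φ]
  have := Module.finitePresentation_of_finite D B
  have : Module.Free (FractionRing D) (LocalizedModule (nonZeroDivisors D) B) :=
    inferInstance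
  obtain ⟨d, hd, h, -⟩ := Module.FinitePresentation.exists_free_localizedModule_powers
    (nonZeroDivisors D) (LocalizedModule.mkLinearMap (nonZeroDivisors D) B) (FractionRing D)
  refine ⟨d, nonZeroDivisors.ne_zero hd, fun D' B' _ _ _ _ _ _ ↦ ?_⟩
  let ψ := IsLocalization.Away.map D' B' φ d
  let : Algebra D' B' := ψ.toAlgebra
  let : Algebra D B' := ((algebraMap B B').comp φ).toAlgebra
  have : IsScalarTower D B B' := .of_algebraMap_eq fun _ ↦ rfl
  have : IsScalarTower D D' B' := .of_algebraMap_eq fun x ↦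
    (IsLocalization.Away.lift_eq d (IsLocalization.Away.algebraMap_isUnit (φ d)) x).symm
  have : IsLocalization (Algebra.algebraMapSubmonoid B (Submonoid.powers d)) B' := by
    rw [Algebra.algebraMapSubmonoid, Submonoid.map_powers]
    assumption
  let e := IsLocalizedModule.iso (Submonoid.powers d) (IsScalarTower.toAlgHom D B B').toLinearMap
  have : Module.Flat D (Localization (Submonoid.powers d)) :=
    IsLocalization.flat _ (Submonoid.powers d)
  have : Module.Flat D (LocalizedModule (Submonoid.powers d) B) :=
    Module.Flat.trans D (Localization (Submonoid.powers d)) _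
  have : Module.Flat D B' := .of_linearEquiv e.symm
  exact (Module.flat_iff_of_isLocalization (R := D) (S := D') (p := Submonoid.powers d) B').mpr this

/-- Generic flatness of a finite morphism. -/
theorem exists_opens_flat {R C : Scheme.{u}} (h : R ⟶ C) [IsFinite h] [IsIntegral C]
    [IsLocallyNoetherian C] :
    ∃ V : C.Opens, genericPoint C ∈ V ∧ Flat (h ∣_ V) := by
  obtain ⟨U, hU, hη, -⟩ := exists_isAffineOpen_mem_and_subset (x := genericPoint C)
    (U := ⊤) trivial
  have : Nonempty U := ⟨_, hη⟩
  have : IsNoetherianRing Γ(C, U) := IsLocallyNoetherian.component_noetherian ⟨U, hU⟩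
  obtain ⟨d, hd, hflat⟩ := exists_flat_awayMap (h.app U).hom (IsFinite.finite_app h U hU)
  refine ⟨C.basicOpen d, ?_, ?_⟩
  · refine ((genericPoint_spec C).mem_open_set_iff (C.basicOpen d).isOpen).mpr ?_
    rw [Set.univ_inter, Set.nonempty_iff_ne_empty]
    intro hempty
    exact hd ((basicOpen_eq_bot_iff d).mp (SetLike.coe_injective hempty))
  · have : IsAffine (C.basicOpen d) := hU.basicOpen d
    have hU' := hU.preimage h
    have : IsAffine (h ⁻¹ᵁ C.basicOpen d) := (hU.basicOpen d).preimage h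
    have := hU.isLocalization_basicOpen d
    have := hU'.isLocalization_basicOpen (h.app U d)
    have H := hflat Γ(C, C.basicOpen d) Γ(R, R.basicOpen (h.app U d))
    have H2 : (h.app (C.basicOpen d)).hom.Flat := by
      rw [hU.app_basicOpen_eq_away_map h hU', CommRingCat.hom_comp,
        RingHom.Flat.respectsIso.cancel_right_isIso]
      exact H
    rw [HasRingHomProperty.iff_of_isAffine (P := @Flat), morphismRestrict_appTop]
    have H3 : (h.app ((C.basicOpen d).ι ''ᵁ ⊤)).hom.Flat := by rwa [Scheme.Opens.ι_image_top]
    exact (RingHom.Flat.respectsIso.cancel_right_isIso (h.app _)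
      (R.presheaf.map (eqToHom (image_morphismRestrict_preimage h (C.basicOpen d) ⊤)).op)).mpr H3

end GenericFlatness

/-! ### Effective epimorphisms in categories of schemes over a base -/

section OverCategory

lemma effectiveEpi_of_effectiveEpi_left {C : Type*} [Category C] {S : C} {X Y : Over S}
    (f : X ⟶ Y) [EffectiveEpi f.left] : EffectiveEpi f := by
  have key {W : Over S} (e : X ⟶ W)
      (h : ∀ {Z : Over S} (g₁ g₂ : Z ⟶ X), g₁ ≫ f = g₂ ≫ f → g₁ ≫ e = g₂ ≫ e) {Z : C}
      (g₁ g₂ : Z ⟶ X.left) (h' : g₁ ≫ f.left = g₂ ≫ f.left) : g₁ ≫ e.left = g₂ ≫ e.left := by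
    have h1 : g₂ ≫ X.hom = g₁ ≫ X.hom := by
      rw [← Over.w f, ← reassoc_of% h']
    exact congr(($(h (Z := Over.mk (g₁ ≫ X.hom)) (Over.homMk g₁) (Over.homMk g₂ h1)
      (by ext; exact h'))).left)
  refine ⟨⟨fun e h ↦ Over.homMk (EffectiveEpi.desc f.left e.left (key e h)) ?_, fun e h ↦ ?_,
    fun e h m hm ↦ ?_⟩⟩
  · rw [← cancel_epi f.left, EffectiveEpi.fac_assoc, Over.w, Over.w]
  · ext
    exact EffectiveEpi.fac f.left e.left (fun {Z} g₁ g₂ h' ↦ key e h g₁ g₂ h')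
  · ext
    exact EffectiveEpi.uniq f.left e.left (fun {Z} g₁ g₂ h' ↦ key e h g₁ g₂ h') m.left
      congr(($hm).left)

variable {S : Scheme.{u}}

lemma isPullback_left {P X Y Z : Over S} {a : P ⟶ X} {b : P ⟶ Y} {f : X ⟶ Z} {g : Y ⟶ Z}
    (h : IsPullback a b f g) : IsPullback a.left b.left f.left g.left :=
  h.map (Over.forget S)

/-- Faithfully flat quasi-compact morphisms are universally effective epimorphisms. -/
lemma effectiveEpi_pullback_fst {U Z P : Over S} (π : U ⟶ Z) (z : P ⟶ Z) [Flat π.left]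
    [Surjective π.left] [QuasiCompact π.left] : EffectiveEpi (pullback.fst z π) := by
  have h := (isPullback_left (IsPullback.of_hasPullback z π)).flip
  have : Flat (pullback.fst z π).left := MorphismProperty.of_isPullback h ‹_›
  have : Surjective (pullback.fst z π).left := MorphismProperty.of_isPullback h ‹_›
  have : QuasiCompact (pullback.fst z π).left := MorphismProperty.of_isPullback h ‹_›
  exact effectiveEpi_of_effectiveEpi_left _

end OverCategory

/-! ### Trivialisations over points -/

section Fibres

variable {k : Type u} [Field k] {G : Over (Spec (.of k))} [GrpObj G]
  {X Y F : Over (Spec (.of k))} [ModObj G X] [ModObj G Y] [ModObj G F] {f : X ⟶ Y} [IsModHom G f]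

instance (y : Y.left) : Mono (pointι Y y) := by
  have : Mono (pointι Y y).left := inferInstanceAs (Mono (Y.left.fromSpecResidueField y))
  exact Over.mono_of_mono_left _

/-- Pairs of points `p`, `q` of the fibre with `g • p = q` in `X` amount to points `p` together with
a point of the stabiliser acting on it. -/
lemma fibreIsTrivial_iff (y : Y.left) :
    FibreIsTrivial G f F y ↔ TrivialAlong G f F (pointι Y y) := by
  refine exists_congr fun φ ↦ and_congr_right fun hφ ↦
    ⟨fun h T g p q hpq ↦ ?_, fun h T g x hx ↦ ?_⟩
  · let s : Stabilizer G Y y T := ⟨g, p ≫ pullback.snd _ _, q ≫ pullback.snd _ _, by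
      rw [Category.assoc, Category.assoc, ← pullback.condition,
        ← Category.assoc p, ← IsModHom.map_smul, hpq, Category.assoc]⟩
    have hs : s.smulFibre f p rfl = q := by
      apply pullback.hom_ext
      · exact (pullback.lift_fst _ _ _).trans hpq
      · exact pullback.lift_snd _ _ _
    have := h T s p rfl =≫ snd _ _
    rw [hs, Stabilizer.smulProd, lift_snd] at this
    simpa using this
  · apply CartesianMonoidalCategory.hom_ext
    · rw [Category.assoc, hφ, Stabilizer.smulProd, lift_fst]
      exact pullback.lift_snd _ _ _
    · rw [Category.assoc, Stabilizer.smulProd, lift_snd, Category.assoc]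
      exact h T g.elt x _ (pullback.lift_fst _ _ _).symm

/-- Every point of an immersed subscheme has the same residue field in the ambient scheme. -/
lemma exists_pointι_eq_comp {B : Over (Spec (.of k))} (i : B ⟶ Y) [IsImmersion i.left]
    (b : B.left) : ∃ j : point Y (i.left b) ⟶ B, j ≫ i = pointι Y (i.left b) := by
  have : IsIso (i.left.residueFieldMap b) := by
    rw [ConcreteCategory.isIso_iff_bijective]
    refine ⟨(i.left.residueFieldMap b).hom.injective, ?_⟩
    have h1 : Function.Surjective (i.left.stalkMap b ≫ B.left.residue b) :=
      (B.left.residue_surjective b).comp (i.left.stalkMap_surjective b)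
    rw [← Scheme.residue_residueFieldMap] at h1
    exact Function.Surjective.of_comp (g := Y.left.residue (i.left b)) h1
  refine ⟨Over.homMk (inv (Spec.map (i.left.residueFieldMap b)) ≫ B.left.fromSpecResidueField b) ?_,
    ?_⟩
  · change (_ ≫ _) ≫ _ = _ ≫ _
    rw [Category.assoc, IsIso.inv_comp_eq, ← Over.w i]
    exact (i.left.SpecMap_residueFieldMap_fromSpecResidueField_assoc b Y.hom).symm
  · ext
    change (_ ≫ _) ≫ _ = _
    rw [Category.assoc, IsIso.inv_comp_eq]
    exact (i.left.SpecMap_residueFieldMap_fromSpecResidueField b).symm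

theorem fibreIsTrivial_of_isPiecewiseTrivialFibrationWithFibre
    (h : IsPiecewiseTrivialFibrationWithFibre G f F) (y : Y.left) : FibreIsTrivial G f F y := by
  obtain ⟨S, hS⟩ := h
  obtain ⟨i, ⟨b, rfl⟩, -⟩ := S.partition y
  have := S.immersion i
  have : Mono (S.emb i) := Over.mono_of_mono_left _
  obtain ⟨j, hj⟩ := exists_pointι_eq_comp (S.emb i) b
  rw [fibreIsTrivial_iff, ← hj]
  exact ((trivialAlong_iff_of_isModHom (S.emb i)).mpr (hS i)).comp j

end Fibres

/-! ### The generic fibre as a limit -/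

section GenericFibre

variable {C : Scheme.{u}} [IsIntegral C]

lemma isIso_residue_genericPoint : IsIso (C.residue (genericPoint C)) := by
  rw [ConcreteCategory.isIso_iff_bijective]
  refine ⟨?_, C.residue_surjective _⟩
  have h : IsField (C.presheaf.stalk (genericPoint C)) := Field.toIsField C.functionField
  let := h.toField
  exact RingHom.injective (IsLocalRing.residue (C.presheaf.stalk (genericPoint C)))

/-- A morphism to an integral scheme with image in the generic point factors through the spectrum
of the function field. -/
lemma exists_comp_fromSpecResidueField_eq {T : Scheme.{u}} (t : T ⟶ C)
    (ht : ∀ x, t x = genericPoint C) :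
    ∃ t' : T ⟶ Spec (C.residueField (genericPoint C)),
      t' ≫ C.fromSpecResidueField (genericPoint C) = t := by
  suffices ∃ t' : T ⟶ Spec (C.presheaf.stalk (genericPoint C)), t' ≫ C.fromSpecStalk _ = t by
    obtain ⟨t', rfl⟩ := this
    have := isIso_residue_genericPoint (C := C)
    exact ⟨t' ≫ inv (Spec.map (C.residue (genericPoint C))), by simp [Scheme.fromSpecResidueField]⟩
  obtain ⟨U, hU, hη, -⟩ := exists_isAffineOpen_mem_and_subset (x := genericPoint C)
    (U := ⊤) trivial
  have : Nonempty U := ⟨_, hη⟩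
  have : IsFractionRing Γ(C, U) C.functionField :=
    functionField_isFractionRing_of_isAffineOpen C U hU
  have htU : t ⁻¹ᵁ U = ⊤ := by
    ext x
    simp [ht, hη]
  let ψ : Γ(C, U) ⟶ Γ(T, ⊤) := t.appLE U ⊤ htU.ge
  have hψ (a : nonZeroDivisors Γ(C, U)) : IsUnit (ψ.hom a) := by
    refine T.toRingedSpace.isUnit_of_isUnit_germ ⊤ _ fun x hx ↦ ?_
    refine (Scheme.mem_basicOpen _ _ _ hx).mp ?_
    rw [Scheme.basicOpen_appLE]
    refine ⟨hx, ?_⟩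
    change t x ∈ C.basicOpen (a : Γ(C, U))
    rw [ht]
    refine (Scheme.mem_basicOpen _ _ _ hη).mpr (isUnit_iff_ne_zero (G₀ := C.functionField).mpr ?_)
    exact IsLocalization.to_map_ne_zero_of_mem_nonZeroDivisors C.functionField le_rfl a.2
  let ψ' : C.presheaf.stalk (genericPoint C) ⟶ Γ(T, ⊤) :=
    CommRingCat.ofHom (IsLocalization.lift (S := C.functionField) hψ)
  have hψ' : C.presheaf.germ U _ hη ≫ ψ' = ψ := by
    ext x
    exact IsLocalization.lift_eq (S := C.functionField) hψ x
  refine ⟨T.toSpecΓ ≫ Spec.map ψ', ?_⟩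
  rw [← hU.fromSpecStalk_eq_fromSpecStalk hη, IsAffineOpen.fromSpecStalk, Category.assoc,
    ← Spec.map_comp_assoc, hψ']
  have h1 := Scheme.Opens.toSpecΓ_SpecMap_appLE_assoc t U ⊤ htU.ge hU.fromSpec
  rw [hU.toSpecΓ_fromSpec, Scheme.Hom.resLE_comp_ι, Scheme.Opens.toSpecΓ_top, Category.assoc] at h1
  exact (cancel_epi T.topIso.hom).mp h1

variable (C) in
/-- The affine open neighbourhoods of the generic point. -/
abbrev GenericNhds : Type u := {V : C.Opens // IsAffineOpen V ∧ genericPoint C ∈ V}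

instance : Nonempty (GenericNhds C) := by
  obtain ⟨U, hU, hη, -⟩ := exists_isAffineOpen_mem_and_subset (x := genericPoint C)
    (U := ⊤) trivial
  exact ⟨U, hU, hη⟩

lemma exists_genericNhds_le (U : C.Opens) (hU : genericPoint C ∈ U) :
    ∃ V : GenericNhds C, V.1 ≤ U := by
  obtain ⟨V, hV, hη, h⟩ := exists_isAffineOpen_mem_and_subset hU
  exact ⟨⟨V, hV, hη⟩, h⟩

instance : IsCodirectedOrder (GenericNhds C) where
  directed V V' := by
    obtain ⟨W, hW⟩ := exists_genericNhds_le (V.1 ⊓ V'.1) ⟨V.2.2, V'.2.2⟩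
    exact ⟨W, hW.trans inf_le_left, hW.trans inf_le_right⟩

lemma eq_genericPoint_of_forall_mem {c : C} (h : ∀ V : GenericNhds C, c ∈ V.1) :
    c = genericPoint C := by
  by_contra hc
  have : genericPoint C ∉ closure {c} := fun h ↦
    hc ((genericPoint_specializes c).antisymm (specializes_iff_mem_closure.mpr h)).symm.eq
  obtain ⟨V, hV⟩ := exists_genericNhds_le ⟨(closure {c})ᶜ, isClosed_closure.isOpen_compl⟩ this
  exact hV (h V) (subset_closure rfl)

variable {R L : Scheme.{u}} (q : R ⟶ C)

/-- The preimages of the affine neighbourhoods of the generic point. -/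
noncomputable def genericDiagram : GenericNhds C ⥤ Scheme.{u} where
  obj V := (q ⁻¹ᵁ V.1 : R.Opens)
  map f := R.homOfLE (q.preimage_mono f.le)

variable {q} {a : L ⟶ R} {b : L ⟶ Spec (C.residueField (genericPoint C))}
  (h : IsPullback a b q (C.fromSpecResidueField (genericPoint C)))

lemma range_subset_preimage (h : IsPullback a b q (C.fromSpecResidueField (genericPoint C)))
    (V : GenericNhds C) : Set.range a ⊆ Set.range (q ⁻¹ᵁ V.1).ι := by
  rintro _ ⟨x, rfl⟩
  rw [Scheme.Opens.range_ι]
  change (q (a x)) ∈ V.1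
  rw [← Scheme.Hom.comp_apply, h.w, Scheme.Hom.comp_apply, Scheme.fromSpecResidueField_apply]
  exact V.2.2

/-- The inclusion of the generic fibre into the preimage of an affine neighbourhood of the generic
point. -/
noncomputable def genericLift (V : GenericNhds C) : L ⟶ (q ⁻¹ᵁ V.1 : R.Opens) :=
  IsOpenImmersion.lift (q ⁻¹ᵁ V.1).ι a (range_subset_preimage h V)

lemma genericLift_ι (V : GenericNhds C) : genericLift h V ≫ (q ⁻¹ᵁ V.1).ι = a :=
  IsOpenImmersion.lift_fac _ _ _

lemma genericLift_ι_assoc (V : GenericNhds C) {T : Scheme.{u}} (t : R ⟶ T) :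
    genericLift h V ≫ (q ⁻¹ᵁ V.1).ι ≫ t = a ≫ t :=
  IsOpenImmersion.lift_fac_assoc _ _ _ _

/-- The generic fibre as a cone over the preimages of the affine neighbourhoods of the generic
point. -/
noncomputable def genericCone : Cone (genericDiagram q) where
  pt := L
  π := {
    app V := genericLift h V
    naturality V V' f := by
      refine (cancel_mono (q ⁻¹ᵁ V'.1).ι).mp ?_
      have : R.homOfLE (q.preimage_mono f.le) ≫ (q ⁻¹ᵁ V'.1).ι = (q ⁻¹ᵁ V.1).ι := by simp
      change (𝟙 L ≫ genericLift h V') ≫ _ =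
        (genericLift h V ≫ R.homOfLE (q.preimage_mono f.le)) ≫ _
      rw [Category.id_comp, Category.assoc, this, genericLift_ι, genericLift_ι] }

lemma exists_comp_genericLift {T : Scheme.{u}}
    (t : ∀ V : GenericNhds C, T ⟶ (q ⁻¹ᵁ V.1 : R.Opens))
    (ht : ∀ {V V' : GenericNhds C} (hV : V ≤ V'),
      t V ≫ R.homOfLE (q.preimage_mono hV) = t V') :
    ∃ l : T ⟶ L, ∀ V, l ≫ genericLift h V = t V := by
  have ht' (V V' : GenericNhds C) : t V ≫ (q ⁻¹ᵁ V.1).ι = t V' ≫ (q ⁻¹ᵁ V'.1).ι := by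
    wlog hV : V ≤ V' generalizing V V' with H
    · obtain ⟨V'', h, h'⟩ := exists_le_le V V'
      rw [← H _ _ h, ← H _ _ h']
    rw [← ht hV]
    simp
  let V₀ : GenericNhds C := Classical.arbitrary _
  obtain ⟨l, hl⟩ := exists_comp_fromSpecResidueField_eq ((t V₀ ≫ (q ⁻¹ᵁ V₀.1).ι) ≫ q) fun x ↦ by
    refine eq_genericPoint_of_forall_mem fun V ↦ ?_
    rw [ht' V₀ V, Category.assoc]
    exact (t V x).2
  refine ⟨h.lift (t V₀ ≫ (q ⁻¹ᵁ V₀.1).ι) l hl.symm, fun V ↦ ?_⟩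
  rw [← cancel_mono (q ⁻¹ᵁ V.1).ι, Category.assoc, genericLift_ι, h.lift_fst, ht' V₀ V]

/-- The generic fibre of a morphism to an integral scheme is the limit of the preimages of the
affine neighbourhoods of the generic point. -/
lemma nonempty_isLimit_genericCone : Nonempty (IsLimit (genericCone h)) := by
  have : Mono a := (MorphismProperty.monomorphisms Scheme).of_isPullback h.flip
    (inferInstanceAs (Mono (C.fromSpecResidueField (genericPoint C))))
  choose t ht using fun s : Cone (genericDiagram q) ↦ exists_comp_genericLift h (T := s.pt)
    (fun V ↦ s.π.app V) (fun hV ↦ s.w (homOfLE hV))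
  refine ⟨⟨t, ht, fun s m hm ↦ ?_⟩⟩
  let V₀ : GenericNhds C := Classical.arbitrary _
  let m' : s.pt ⟶ L := m
  have h1 : (m' ≫ genericLift h V₀) ≫ (q ⁻¹ᵁ V₀.1).ι = (t s ≫ genericLift h V₀) ≫ (q ⁻¹ᵁ V₀.1).ι :=
    congr($((hm V₀).trans (ht s V₀).symm) ≫ (q ⁻¹ᵁ V₀.1).ι)
  rw [Category.assoc, Category.assoc, genericLift_ι] at h1
  exact (cancel_mono a).mp h1

instance {V V' : GenericNhds C} (f : V ⟶ V') : IsAffineHom ((genericDiagram q).map f) := by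
  have h1 : IsPullback (R.homOfLE (q.preimage_mono f.le)) (q ∣_ V.1) (q ∣_ V'.1)
      (C.homOfLE f.le) := by
    refine .of_right (h₁₂ := (q ⁻¹ᵁ V'.1).ι) (h₂₂ := V'.1.ι) (v₁₃ := q) ?_ ?_
      (isPullback_morphismRestrict q V'.1).flip
    · simpa using (isPullback_morphismRestrict q V.1).flip
    · simp [← cancel_mono V'.1.ι]
  have : IsAffine V.1 := V.2.1
  have : IsAffine V'.1 := V'.2.1
  exact MorphismProperty.of_isPullback h1.flip (inferInstanceAs (IsAffineHom (C.homOfLE f.le)))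

variable {S Q : Scheme.{u}} [IsNoetherian R]

instance (V : GenericNhds C) : CompactSpace ((genericDiagram q).obj V) :=
  isCompact_iff_compactSpace.mp (TopologicalSpace.NoetherianSpace.isCompact (q ⁻¹ᵁ V.1 : Set R))

instance (V : GenericNhds C) : QuasiSeparatedSpace ((genericDiagram q).obj V) :=
  inferInstanceAs (QuasiSeparatedSpace (q ⁻¹ᵁ V.1 : R.Opens))

/-- The structure morphism of `genericDiagram`. -/
noncomputable def genericDiagramHom (σ : R ⟶ S) :
    genericDiagram q ⟶ (Functor.const (GenericNhds C)).obj S where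
  app V := ((q ⁻¹ᵁ V.1).ι ≫ σ : (q ⁻¹ᵁ V.1 : R.Opens).toScheme ⟶ S)
  naturality V V' f := by
    change R.homOfLE (q.preimage_mono f.le) ≫ (q ⁻¹ᵁ V'.1).ι ≫ σ = ((q ⁻¹ᵁ V.1).ι ≫ σ) ≫ 𝟙 S
    rw [Scheme.homOfLE_ι_assoc, Category.comp_id]

/-- Two morphisms to a scheme locally of finite type which agree on the generic fibre agree over a
neighbourhood of the generic point. -/
lemma exists_ι_comp_eq_of_generic
    (h : IsPullback a b q (C.fromSpecResidueField (genericPoint C)))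
    (f : Q ⟶ S) [LocallyOfFiniteType f] (m₁ m₂ : R ⟶ Q)
    (hf : m₁ ≫ f = m₂ ≫ f) (hm : a ≫ m₁ = a ≫ m₂) :
    ∃ V : GenericNhds C, (q ⁻¹ᵁ V.1).ι ≫ m₁ = (q ⁻¹ᵁ V.1).ι ≫ m₂ := by
  obtain ⟨hl⟩ := nonempty_isLimit_genericCone h
  let V₀ : GenericNhds C := Classical.arbitrary _
  let n₁ : (q ⁻¹ᵁ V₀.1 : R.Opens).toScheme ⟶ Q := (q ⁻¹ᵁ V₀.1).ι ≫ m₁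
  let n₂ : (q ⁻¹ᵁ V₀.1 : R.Opens).toScheme ⟶ Q := (q ⁻¹ᵁ V₀.1).ι ≫ m₂
  have hn : genericLift h V₀ ≫ n₁ = genericLift h V₀ ≫ n₂ := by
    rw [genericLift_ι_assoc, genericLift_ι_assoc, hm]
  obtain ⟨V, i, hV⟩ := Scheme.exists_hom_comp_eq_comp_of_locallyOfFiniteType (genericDiagram q)
    (genericDiagramHom (m₁ ≫ f)) f _ hl (i := V₀) n₁ n₂
    (Category.assoc (q ⁻¹ᵁ V₀.1).ι m₁ f).symm
    (hf ▸ (Category.assoc (q ⁻¹ᵁ V₀.1).ι m₂ f).symm) hn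
  refine ⟨V, ?_⟩
  change R.homOfLE (q.preimage_mono i.le) ≫ (q ⁻¹ᵁ V₀.1).ι ≫ m₁ =
    R.homOfLE (q.preimage_mono i.le) ≫ (q ⁻¹ᵁ V₀.1).ι ≫ m₂ at hV
  rwa [Scheme.homOfLE_ι_assoc, Scheme.homOfLE_ι_assoc] at hV

/-- A morphism from the generic fibre to a scheme locally of finite presentation extends over a
neighbourhood of the generic point. -/
lemma exists_genericLift_comp_eq (σ : R ⟶ S) (f : Q ⟶ S) [LocallyOfFinitePresentation f]
    (m : L ⟶ Q) (hm : m ≫ f = a ≫ σ) :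
    ∃ (V : GenericNhds C) (m' : (q ⁻¹ᵁ V.1 : R.Opens).toScheme ⟶ Q),
      m' ≫ f = (q ⁻¹ᵁ V.1).ι ≫ σ ∧ genericLift h V ≫ m' = m := by
  obtain ⟨hl⟩ := nonempty_isLimit_genericCone h
  obtain ⟨V, m', h1, h2⟩ := Scheme.exists_π_app_comp_eq_of_locallyOfFinitePresentation
    (genericDiagram q) (genericDiagramHom σ) f _ hl m (by
      ext V
      change genericLift h V ≫ (q ⁻¹ᵁ V.1).ι ≫ σ = m ≫ f
      rw [genericLift_ι_assoc, hm])
  exact ⟨V, m', h2, h1⟩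

end GenericFibre

/-! ### Varieties and their open subschemes -/

section Varieties

variable {k : Type u} [Field k] {X Y Z : Over (Spec (.of k))}

lemma IsVariety.isNoetherian (hX : IsVariety X) : IsNoetherian X.left := by
  have := hX.locallyOfFiniteType
  have := hX.quasiCompact
  have : IsLocallyNoetherian X.left := LocallyOfFiniteType.isLocallyNoetherian X.hom
  have : CompactSpace X.left := QuasiCompact.compactSpace_of_compactSpace X.hom
  exact {}

lemma isVariety_of_hom (hY : IsVariety Y) (f : X ⟶ Y) [LocallyOfFiniteType f.left]
    [QuasiCompact f.left] [IsSeparated f.left] : IsVariety X := by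
  obtain ⟨_, _, _⟩ := hY
  constructor <;> rw [← Over.w f] <;> infer_instance

lemma IsVariety.pullback (hX : IsVariety X) (hY : IsVariety Y) (hZ : IsVariety Z) (f : X ⟶ Z)
    (g : Y ⟶ Z) : IsVariety (pullback f g) := by
  have h := (isPullback_left (IsPullback.of_hasPullback f g)).flip
  have := hY.locallyOfFiniteType
  have := hY.quasiCompact
  have := hY.isSeparated
  have := hZ.isSeparated
  have : LocallyOfFiniteType (g.left ≫ Z.hom) := by rwa [Over.w g]
  have : QuasiCompact (g.left ≫ Z.hom) := by rwa [Over.w g]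
  have : IsSeparated (g.left ≫ Z.hom) := by rwa [Over.w g]
  have : LocallyOfFiniteType g.left := locallyOfFiniteType_of_comp g.left Z.hom
  have : QuasiCompact g.left := QuasiCompact.of_comp g.left Z.hom
  have : IsSeparated g.left := IsSeparated.of_comp g.left Z.hom
  have : LocallyOfFiniteType (pullback.fst f g).left := MorphismProperty.of_isPullback h ‹_›
  have : QuasiCompact (pullback.fst f g).left := MorphismProperty.of_isPullback h ‹_›
  have : IsSeparated (pullback.fst f g).left := MorphismProperty.of_isPullback h ‹_›
  exact isVariety_of_hom hX (pullback.fst f g)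

lemma isPullback_tensor_left (X Y : Over (Spec (.of k))) :
    IsPullback (fst X Y).left (snd X Y).left X.hom Y.hom := by
  exact IsPullback.of_hasPullback X.hom Y.hom

lemma IsVariety.tensor (hX : IsVariety X) (hY : IsVariety Y) : IsVariety (X ⊗ Y) := by
  have h := (isPullback_tensor_left X Y).flip
  have := hY.locallyOfFiniteType
  have := hY.quasiCompact
  have := hY.isSeparated
  have : LocallyOfFiniteType (fst X Y).left := MorphismProperty.of_isPullback h ‹_›
  have : QuasiCompact (fst X Y).left := MorphismProperty.of_isPullback h ‹_›
  have : IsSeparated (fst X Y).left := MorphismProperty.of_isPullback h ‹_›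
  exact isVariety_of_hom hX (fst X Y)

lemma isVariety_of_isFinite [IsFinite X.hom] : IsVariety X :=
  ⟨inferInstance, inferInstance, inferInstance⟩

/-- An open subscheme of a `k`-scheme, as a `k`-scheme. -/
noncomputable abbrev opensOver (X : Over (Spec (.of k))) (V : X.left.Opens) : Over (Spec (.of k)) :=
  Over.mk (V.ι ≫ X.hom)

/-- The inclusion of an open subscheme. -/
noncomputable abbrev opensι (X : Over (Spec (.of k))) (V : X.left.Opens) : opensOver X V ⟶ X :=
  Over.homMk V.ι

instance (V : X.left.Opens) : Mono (opensι X V) := by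
  have : Mono (opensι X V).left := inferInstanceAs (Mono V.ι)
  exact Over.mono_of_mono_left _

lemma exists_comp_opensι_eq (V : X.left.Opens) (f : Y ⟶ X) (h : ∀ y, f.left y ∈ V) :
    ∃ f' : Y ⟶ opensOver X V, f' ≫ opensι X V = f := by
  have h' : Set.range f.left ⊆ Set.range V.ι := by
    rintro _ ⟨y, rfl⟩
    rw [Scheme.Opens.range_ι]
    exact h y
  refine ⟨Over.homMk (IsOpenImmersion.lift V.ι f.left h') ?_, ?_⟩
  · change _ ≫ V.ι ≫ X.hom = _
    rw [IsOpenImmersion.lift_fac_assoc, Over.w]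
  · ext
    exact IsOpenImmersion.lift_fac _ _ _

lemma opensι_mem (V : X.left.Opens) (x : (opensOver X V).left) : (opensι X V).left x ∈ V := x.2

lemma comp_opensι_mem {T : Over (Spec (.of k))} (V : X.left.Opens) (t : T ⟶ opensOver X V)
    (x : T.left) : (t ≫ opensι X V).left x ∈ V := by
  rw [Over.comp_left, Scheme.Hom.comp_apply]
  exact opensι_mem V _

lemma IsVariety.opensOver (hX : IsVariety X) (V : X.left.Opens) : IsVariety (opensOver X V) := by
  have := hX.isNoetherian
  have : IsOpenImmersion (opensι X V).left := inferInstanceAs (IsOpenImmersion V.ι)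
  have : QuasiCompact (opensι X V).left := inferInstanceAs (QuasiCompact V.ι)
  exact isVariety_of_hom hX (opensι X V)

end Varieties

/-! ### Spreading out morphisms from the generic fibre -/

section SpreadingOut

variable {k : Type u} [Field k] {C : Over (Spec (.of k))} [IsIntegral C.left]

lemma exists_comp_pointι_eq {T : Over (Spec (.of k))} (t : T ⟶ C)
    (ht : ∀ x, t.left x = genericPoint C.left) :
    ∃ t' : T ⟶ point C (genericPoint C.left), t' ≫ pointι C (genericPoint C.left) = t := by
  obtain ⟨t', h⟩ := exists_comp_fromSpecResidueField_eq t.left ht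
  refine ⟨Over.homMk t' ?_, ?_⟩
  · change _ ≫ _ ≫ C.hom = _
    rw [reassoc_of% h, Over.w]
  · ext
    exact h

variable {R L Q : Over (Spec (.of k))} {q : R ⟶ C} {a : L ⟶ R}
  {b : L ⟶ point C (genericPoint C.left)}

/-- A morphism `m` from the generic fibre `L` of `q : R ⟶ C` extends to `q⁻¹(V)` for a neighbourhood
`V` of the generic point. The extension is given on every `D ⟶ R` with image in `q⁻¹(V)`, which
covers the various forms in which `q⁻¹(V)` is presented. -/
lemma exists_extension_of_isPullback (h : IsPullback a b q (pointι C (genericPoint C.left)))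
    (hR : IsVariety R) (hQ : IsVariety Q) (m : L ⟶ Q) :
    ∃ V : GenericNhds C.left, ∀ {D : Over (Spec (.of k))} (d : D ⟶ R),
      (∀ x, (d ≫ q).left x ∈ V.1) → ∃ m' : D ⟶ Q, ∀ {T : Over (Spec (.of k))} (t : T ⟶ L)
        (s : T ⟶ D), t ≫ a = s ≫ d → s ≫ m' = t ≫ m := by
  have := hR.isNoetherian
  have := hQ.locallyOfFiniteType
  have : LocallyOfFinitePresentation Q.hom :=
    LocallyOfFinitePresentation.iff_locallyOfFiniteType.mpr ‹_›
  have hl := isPullback_left h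
  obtain ⟨V, m', h1, h2⟩ := exists_genericLift_comp_eq hl R.hom Q.hom m.left
    ((Over.w m).trans (Over.w a).symm)
  let n : opensOver R (q.left ⁻¹ᵁ V.1) ⟶ Q := Over.homMk m' h1
  refine ⟨V, fun {D} d hd ↦ ?_⟩
  obtain ⟨d', hd'⟩ := exists_comp_opensι_eq (q.left ⁻¹ᵁ V.1) d hd
  refine ⟨d' ≫ n, fun {T} t s hts ↦ ?_⟩
  let l : L ⟶ opensOver R (q.left ⁻¹ᵁ V.1) := Over.homMk (genericLift hl V) (by
    change _ ≫ _ ≫ R.hom = _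
    exact (genericLift_ι_assoc hl V R.hom).trans (Over.w a))
  have hla : l ≫ opensι R _ = a := by
    ext
    exact genericLift_ι hl V
  have hln : l ≫ n = m := by
    ext
    exact h2
  have : s ≫ d' = t ≫ l := by
    rw [← cancel_mono (opensι R _), Category.assoc, hd', Category.assoc, hla, hts]
  rw [reassoc_of% this, hln]

/-- Morphisms which agree over the generic point of `C` agree over a neighbourhood. -/
lemma exists_comp_eq_of_generic (q : R ⟶ C) (hR : IsVariety R) (hQ : IsVariety Q)
    (m₁ m₂ : R ⟶ Q)
    (h : ∀ {T : Over (Spec (.of k))} (t : T ⟶ R) (p : T ⟶ point C (genericPoint C.left)),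
      t ≫ q = p ≫ pointι C (genericPoint C.left) → t ≫ m₁ = t ≫ m₂) :
    ∃ V : GenericNhds C.left, ∀ {T : Over (Spec (.of k))} (t : T ⟶ R),
      (∀ x, (t ≫ q).left x ∈ V.1) → t ≫ m₁ = t ≫ m₂ := by
  have := hR.isNoetherian
  have := hQ.locallyOfFiniteType
  obtain ⟨V, hV⟩ := exists_ι_comp_eq_of_generic
    (isPullback_left (IsPullback.of_hasPullback q (pointι C (genericPoint C.left)))) Q.hom
    m₁.left m₂.left ((Over.w m₁).trans (Over.w m₂).symm)
    congr(($(h _ _ pullback.condition)).left)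
  refine ⟨V, fun {T} t ht ↦ ?_⟩
  obtain ⟨t', rfl⟩ := exists_comp_opensι_eq (q.left ⁻¹ᵁ V.1) t ht
  have : opensι R (q.left ⁻¹ᵁ V.1) ≫ m₁ = opensι R (q.left ⁻¹ᵁ V.1) ≫ m₂ := by
    ext
    exact hV
  rw [Category.assoc, this, Category.assoc]

end SpreadingOut

/-! ### Spreading out trivialisations -/

section SpreadingOutTrivialisations

variable {k : Type u} [Field k] {G : Over (Spec (.of k))} [GrpObj G]
  {X Y F : Over (Spec (.of k))} [ModObj G X] [ModObj G Y] [ModObj G F] {f : X ⟶ Y} [IsModHom G f]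
  {C : Over (Spec (.of k))} [IsIntegral C.left]

/-- A trivialisation over the generic point of `C` extends to a neighbourhood. For this, `G` must
not carry the generic point of `C` to another point of `C`, which is the content of `hc`: the
equivariance over the generic point only concerns pairs of points which both lie over it. -/
theorem exists_trivialAlong_opensι (hG : IsVariety G) (hX : IsVariety X) (hY : IsVariety Y)
    (hF : IsVariety F) (hC : IsVariety C) (c : C ⟶ Y)
    (hc : ∀ {T : Over (Spec (.of k))} (g : T ⟶ G) (w w' : T ⟶ C), g • (w ≫ c) = w' ≫ c →
      (∀ x, w.left x = genericPoint C.left) → ∀ x, w'.left x = genericPoint C.left)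
    (h : TrivialAlong G f F (pointι C (genericPoint C.left) ≫ c)) :
    ∃ V : GenericNhds C.left, TrivialAlong G f F (opensι C V.1 ≫ c) := by
  set e := pointι C (genericPoint C.left)
  obtain ⟨φ, hφ, hφG⟩ := h
  have hφ' : φ.inv ≫ pullback.snd f (e ≫ c) = fst _ F := by rw [← hφ, Iso.inv_hom_id_assoc]
  let α : pullback f (e ≫ c) ⟶ F := φ.hom ≫ snd _ F
  let β : point C (genericPoint C.left) ⊗ F ⟶ X := φ.inv ≫ pullback.fst f (e ≫ c)
  have hβ : β ≫ f = fst _ F ≫ e ≫ c := by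
    rw [Category.assoc, pullback.condition, reassoc_of% hφ']
  let a₁ : pullback f (e ≫ c) ⟶ pullback f c :=
    pullback.lift (pullback.fst _ _) (pullback.snd _ _ ≫ e) (by
      rw [pullback.condition, Category.assoc])
  have ha₁ : IsPullback a₁ (pullback.snd f (e ≫ c)) (pullback.snd f c) e := by
    refine .of_right (h₁₂ := pullback.fst f c) (h₂₂ := c) (v₁₃ := f) ?_ (pullback.lift_snd _ _ _)
      (.of_hasPullback f c)
    simpa only [a₁, pullback.lift_fst] using IsPullback.of_hasPullback f (e ≫ c)
  have ha₂ : IsPullback (e ▷ F) (fst (point C (genericPoint C.left)) F) (fst C F) e := by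
    refine ⟨⟨by simp⟩, ⟨PullbackCone.IsLimit.mk _ (fun s ↦ lift s.snd (s.fst ≫ snd C F))
      (fun s ↦ ?_) (fun s ↦ ?_) (fun s m h1 h2 ↦ ?_)⟩⟩
    · apply CartesianMonoidalCategory.hom_ext <;> simp [s.condition]
    · simp
    · apply CartesianMonoidalCategory.hom_ext
      · simpa using h2
      · simp [← h1]
  -- The components `α`, `β` are not morphisms over `Y`, nor inverse to each other, once extended;
  -- each identity is an equality of morphisms which holds generically, hence after shrinking `V`.
  obtain ⟨V₁, H₁⟩ := exists_extension_of_isPullback ha₁ (hX.pullback hC hY f c) hF α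
  obtain ⟨V₂, H₂⟩ := exists_extension_of_isPullback ha₂ (hC.tensor hF) hX β
  obtain ⟨V₀, hV₁, hV₂⟩ := exists_le_le V₁ V₂
  obtain ⟨α₀, hα₀⟩ : ∃ α₀ : pullback f (opensι C V₀.1 ≫ c) ⟶ F,
      ∀ {T : Over (Spec (.of k))} (t : T ⟶ pullback f (e ≫ c))
        (s : T ⟶ pullback f (opensι C V₀.1 ≫ c)),
        t ≫ pullback.fst _ _ = s ≫ pullback.fst _ _ →
        (t ≫ pullback.snd _ _) ≫ e = (s ≫ pullback.snd _ _) ≫ opensι C V₀.1 →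
        s ≫ α₀ = t ≫ α := by
    let r : pullback f (opensι C V₀.1 ≫ c) ⟶ pullback f c :=
      pullback.lift (pullback.fst _ _) (pullback.snd _ _ ≫ opensι C V₀.1) (by
        rw [pullback.condition, Category.assoc])
    obtain ⟨α₀, h⟩ := H₁ r fun x ↦ hV₁ (by
      simp only [r, pullback.lift_snd]
      exact comp_opensι_mem V₀.1 _ x)
    refine ⟨α₀, fun t s h1 h2 ↦ h t s ?_⟩
    apply pullback.hom_ext
    · simpa [r, a₁, pullback.lift_fst] using h1
    · simpa [r, a₁, pullback.lift_snd] using h2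
  obtain ⟨β₀, hβ₀⟩ : ∃ β₀ : opensOver C V₀.1 ⊗ F ⟶ X,
      ∀ {T : Over (Spec (.of k))} (t : T ⟶ point C (genericPoint C.left) ⊗ F)
        (s : T ⟶ opensOver C V₀.1 ⊗ F), (t ≫ fst _ _) ≫ e = (s ≫ fst _ _) ≫ opensι C V₀.1 →
        t ≫ snd _ _ = s ≫ snd _ _ → s ≫ β₀ = t ≫ β := by
    obtain ⟨β₀, h⟩ := H₂ (opensι C V₀.1 ▷ F) fun x ↦ hV₂ (by
      rw [whiskerRight_fst]
      exact comp_opensι_mem V₀.1 _ x)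
    refine ⟨β₀, fun t s h1 h2 ↦ h t s ?_⟩
    apply CartesianMonoidalCategory.hom_ext
    · simpa using h1
    · simpa using h2
  clear H₁ H₂
  obtain ⟨V₃, hV₃⟩ := exists_comp_eq_of_generic (fst _ F ≫ opensι C V₀.1)
    ((hC.opensOver _).tensor hF) hY (β₀ ≫ f) (fst _ F ≫ opensι C V₀.1 ≫ c) fun t p h ↦ by
      rw [← Category.assoc, hβ₀ (lift p (t ≫ snd _ _)) t (by simpa using h.symm) (by simp),
        Category.assoc, hβ, lift_fst_assoc, ← reassoc_of% h]
  obtain ⟨V₄, hV₄, hV₃₄⟩ := exists_le_le V₀ V₃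
  obtain ⟨j, hj⟩ := exists_comp_opensι_eq V₀.1 (opensι C V₄.1) fun x ↦ hV₄ (opensι_mem _ x)
  let α₄ : pullback f (opensι C V₄.1 ≫ c) ⟶ F :=
    pullback.lift (pullback.fst _ _) (pullback.snd _ _ ≫ j) (by
      rw [pullback.condition, Category.assoc, reassoc_of% hj]) ≫ α₀
  let β₄ : opensOver C V₄.1 ⊗ F ⟶ X := (j ▷ F) ≫ β₀
  have hα₄ {T : Over (Spec (.of k))} (t : T ⟶ pullback f (e ≫ c))
      (s : T ⟶ pullback f (opensι C V₄.1 ≫ c))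
      (h1 : t ≫ pullback.fst _ _ = s ≫ pullback.fst _ _)
      (h2 : (t ≫ pullback.snd _ _) ≫ e = (s ≫ pullback.snd _ _) ≫ opensι C V₄.1) :
      s ≫ α₄ = t ≫ α := by
    rw [← Category.assoc]
    refine hα₀ _ _ ?_ ?_
    · simpa [pullback.lift_fst] using h1
    · simpa [pullback.lift_snd_assoc, hj] using h2
  have hβ₄ {T : Over (Spec (.of k))} (t : T ⟶ point C (genericPoint C.left) ⊗ F)
      (s : T ⟶ opensOver C V₄.1 ⊗ F) (h1 : (t ≫ fst _ _) ≫ e = (s ≫ fst _ _) ≫ opensι C V₄.1)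
      (h2 : t ≫ snd _ _ = s ≫ snd _ _) : s ≫ β₄ = t ≫ β := by
    rw [← Category.assoc]
    refine hβ₀ _ _ ?_ ?_
    · simpa [hj] using h1
    · simpa using h2
  have hβf : β₄ ≫ f = fst _ F ≫ opensι C V₄.1 ≫ c := by
    rw [Category.assoc, hV₃ (j ▷ F) fun x ↦ hV₃₄ (by
      rw [whiskerRight_fst_assoc, hj]
      exact comp_opensι_mem V₄.1 _ x)]
    simp [reassoc_of% hj]
  clear_value α₄ β₄
  clear hα₀ hβ₀ hV₃ hj
  have hP := hX.pullback (hC.opensOver V₄.1) hY f (opensι C V₄.1 ≫ c)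
  obtain ⟨V₅, hV₅⟩ := exists_comp_eq_of_generic (fst _ F ≫ opensι C V₄.1)
    ((hC.opensOver _).tensor hF) hF (pullback.lift β₄ (fst _ F) hβf ≫ α₄) (snd _ F) fun t p h ↦ by
      let t' : _ ⟶ point C (genericPoint C.left) ⊗ F := lift p (t ≫ snd _ _)
      have h1 := hβ₄ t' t (by simpa [t'] using h.symm) (by simp [t'])
      rw [← Category.assoc, hα₄ (t' ≫ φ.inv)]
      · simp [α, t']
      · simp [pullback.lift_fst, h1, β]
      · simpa [pullback.lift_snd, hφ', t'] using h.symm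
  obtain ⟨V₆, hV₆⟩ := exists_comp_eq_of_generic (pullback.snd f (opensι C V₄.1 ≫ c) ≫ opensι C V₄.1)
    hP hX (lift (pullback.snd f (opensι C V₄.1 ≫ c)) α₄ ≫ β₄)
    (pullback.fst f (opensι C V₄.1 ≫ c)) fun t p h ↦ by
      let u : _ ⟶ pullback f (e ≫ c) := pullback.lift (t ≫ pullback.fst _ _) p (by
        rw [Category.assoc, pullback.condition, ← reassoc_of% h])
      have h1 := hα₄ u t (pullback.lift_fst _ _ _)
        (by simpa [u, pullback.lift_snd] using h.symm)
      rw [← Category.assoc, hβ₄ (u ≫ φ.hom)]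
      · simp [β, u, pullback.lift_fst]
      · rw [Category.assoc, Category.assoc, reassoc_of% hφ, pullback.lift_snd_assoc, ← h]
        simp
      · simp [h1, α]
  -- Equivariance is an identity on the scheme of triples `(g, p, p')` with `g • p = p'` in `X`. On
  -- its generic fibre, `p` lies over the generic point of `C`, and then so does `p'` by `hc`.
  let act : G ⊗ pullback f (opensι C V₄.1 ≫ c) ⟶ X :=
    fst G (pullback f (opensι C V₄.1 ≫ c)) •
      (snd G (pullback f (opensι C V₄.1 ≫ c)) ≫ pullback.fst f (opensι C V₄.1 ≫ c))
  obtain ⟨V₇, hV₇⟩ := exists_comp_eq_of_generic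
    (pullback.fst act (pullback.fst f (opensι C V₄.1 ≫ c)) ≫ snd _ _ ≫
      pullback.snd f (opensι C V₄.1 ≫ c) ≫ opensι C V₄.1)
    ((hG.tensor hP).pullback hP hX _ _) hF
    (pullback.snd act (pullback.fst f (opensι C V₄.1 ≫ c)) ≫ α₄)
    ((pullback.fst act (pullback.fst f (opensι C V₄.1 ≫ c)) ≫ fst _ _) •
      (pullback.fst act (pullback.fst f (opensι C V₄.1 ≫ c)) ≫ snd _ _ ≫ α₄)) fun {T} t p h ↦ by
      let g := t ≫ pullback.fst act (pullback.fst f (opensι C V₄.1 ≫ c)) ≫ fst _ _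
      let x := t ≫ pullback.fst act (pullback.fst f (opensι C V₄.1 ≫ c)) ≫ snd _ _
      let x' := t ≫ pullback.snd act (pullback.fst f (opensι C V₄.1 ≫ c))
      have hx : g • (x ≫ pullback.fst f (opensι C V₄.1 ≫ c)) =
          x' ≫ pullback.fst f (opensι C V₄.1 ≫ c) := by
        have := t ≫= pullback.condition (f := act) (g := pullback.fst f (opensι C V₄.1 ≫ c))
        simpa [act, ModObj.comp_smul, g, x, x'] using this
      have hxp : (x ≫ pullback.snd f (opensι C V₄.1 ≫ c)) ≫ opensι C V₄.1 = p ≫ e := by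
        simpa [x] using h
      have hw : g • (((x ≫ pullback.snd f (opensι C V₄.1 ≫ c)) ≫ opensι C V₄.1) ≫ c) =
          ((x' ≫ pullback.snd f (opensι C V₄.1 ≫ c)) ≫ opensι C V₄.1) ≫ c := by
        have h1 {T : Over (Spec (.of k))} (y : T ⟶ pullback f (opensι C V₄.1 ≫ c)) :
            ((y ≫ pullback.snd f (opensι C V₄.1 ≫ c)) ≫ opensι C V₄.1) ≫ c =
              (y ≫ pullback.fst f (opensι C V₄.1 ≫ c)) ≫ f := by
          rw [Category.assoc, Category.assoc, Category.assoc, ← pullback.condition]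
        rw [h1, h1, ← IsModHom.map_smul, hx]
      obtain ⟨p', hp'⟩ := exists_comp_pointι_eq _ (hc _ _ _ hw fun y ↦ by
        rw [hxp, Over.comp_left, Scheme.Hom.comp_apply]
        exact Scheme.fromSpecResidueField_apply _ _)
      let u : T ⟶ pullback f (e ≫ c) := pullback.lift (x ≫ pullback.fst _ _) p (by
        rw [← reassoc_of% hxp, Category.assoc, pullback.condition, Category.assoc])
      let u' : T ⟶ pullback f (e ≫ c) := pullback.lift (x' ≫ pullback.fst _ _) p' (by
        rw [reassoc_of% hp', Category.assoc, pullback.condition])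
      have hu := hα₄ u x (pullback.lift_fst _ _ _) (by rw [pullback.lift_snd, hxp])
      have hu' := hα₄ u' x' (pullback.lift_fst _ _ _) (by rw [pullback.lift_snd, hp'])
      have := hφG T g u u' (by rw [pullback.lift_fst, pullback.lift_fst, hx])
      rw [ModObj.comp_smul]
      simp only [← Category.assoc] at hu hu' this ⊢
      exact hu'.trans (this.trans congr(g • $hu.symm))
  obtain ⟨V₈, hV₈₄, hV₈₅⟩ := exists_le_le V₄ V₅
  obtain ⟨V₉, hV₉₆, hV₉₇⟩ := exists_le_le V₆ V₇
  obtain ⟨V, hV₈, hV₉⟩ := exists_le_le V₈ V₉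
  obtain ⟨j, hj⟩ := exists_comp_opensι_eq V₄.1 (opensι C V.1) fun x ↦
    (hV₈.trans hV₈₄) (opensι_mem _ x)
  let r : pullback f (opensι C V.1 ≫ c) ⟶ pullback f (opensι C V₄.1 ≫ c) :=
    pullback.lift (pullback.fst _ _) (pullback.snd _ _ ≫ j) (by
      rw [pullback.condition, Category.assoc, reassoc_of% hj])
  have hr₁ : r ≫ pullback.fst f (opensι C V₄.1 ≫ c) = pullback.fst _ _ := pullback.lift_fst _ _ _
  have hr₂ : r ≫ pullback.snd f (opensι C V₄.1 ≫ c) = pullback.snd _ _ ≫ j :=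
    pullback.lift_snd _ _ _
  have hβ' : ((j ▷ F) ≫ β₄) ≫ f = fst _ F ≫ opensι C V.1 ≫ c := by
    rw [Category.assoc, hβf, whiskerRight_fst_assoc, reassoc_of% hj]
  refine ⟨V, .of_components (r ≫ α₄) ((j ▷ F) ≫ β₄) hβ' ?_ ?_ ?_⟩
  · have h1 : pullback.lift ((j ▷ F) ≫ β₄) (fst _ F) hβ' ≫ r =
        (j ▷ F) ≫ pullback.lift β₄ (fst _ F) hβf := by
      apply pullback.hom_ext
      · simp [hr₁, pullback.lift_fst]
      · simp [hr₂, pullback.lift_snd, pullback.lift_snd_assoc]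
    rw [reassoc_of% h1, hV₅ (j ▷ F) fun x ↦ (hV₈.trans hV₈₅) (by
      rw [whiskerRight_fst_assoc, hj]
      exact comp_opensι_mem V.1 _ x), whiskerRight_snd]
  · have h1 : lift (pullback.snd f (opensι C V.1 ≫ c)) (r ≫ α₄) ≫ j ▷ F =
        r ≫ lift (pullback.snd f (opensι C V₄.1 ≫ c)) α₄ := by
      apply CartesianMonoidalCategory.hom_ext <;> simp [hr₂]
    rw [reassoc_of% h1, hV₆ r fun x ↦ (hV₉.trans hV₉₆) (by
      rw [reassoc_of% hr₂, hj]
      exact comp_opensι_mem V.1 _ x), hr₁]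
  · intro T g x x' hx
    let t : T ⟶ pullback act (pullback.fst f (opensι C V₄.1 ≫ c)) :=
      pullback.lift (lift g (x ≫ r)) (x' ≫ r) (by
        rw [Category.assoc, hr₁, ← hx]
        simp [act, ModObj.comp_smul, hr₁])
    have ht₁ : t ≫ pullback.fst _ _ = lift g (x ≫ r) := pullback.lift_fst _ _ _
    have ht₂ : t ≫ pullback.snd _ _ = x' ≫ r := pullback.lift_snd _ _ _
    have := hV₇ t fun y ↦ (hV₉.trans hV₉₇) (by
      rw [reassoc_of% ht₁, lift_snd_assoc, Category.assoc, reassoc_of% hr₂, hj, ← Category.assoc]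
      exact comp_opensι_mem V.1 _ y)
    rw [ModObj.comp_smul, reassoc_of% ht₁, reassoc_of% ht₁, reassoc_of% ht₂] at this
    simpa using this

end SpreadingOutTrivialisations

/-! ### The action map -/

section OrbitMap

variable {C : Type*} [Category C] [CartesianMonoidalCategory C] (G Y : C) [GrpObj G] [ModObj G Y]

/-- The involution `(g, y) ↦ (g⁻¹, g • y)` of `G × Y`. It exchanges the projection and the
action. -/
def swapAction : G ⊗ Y ≅ G ⊗ Y where
  hom := lift (fst G Y)⁻¹ (fst G Y • snd G Y)
  inv := lift (fst G Y)⁻¹ (fst G Y • snd G Y)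
  hom_inv_id := by
    apply CartesianMonoidalCategory.hom_ext <;> simp [ModObj.comp_smul, GrpObj.comp_inv]
  inv_hom_id := by
    apply CartesianMonoidalCategory.hom_ext <;> simp [ModObj.comp_smul, GrpObj.comp_inv]

lemma smul_eq : (γ[G, Y] : G ⊗ Y ⟶ Y) = fst G Y • snd G Y := by
  rw [Hom.smul_def, lift_fst_snd, Category.id_comp]

lemma swapAction_hom_snd : (swapAction G Y).hom ≫ snd G Y = γ[G, Y] := by
  rw [smul_eq]
  simp [swapAction]

lemma swapAction_hom_smul : (swapAction G Y).hom ≫ γ[G, Y] = snd G Y := by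
  rw [smul_eq]
  simp [swapAction, ModObj.comp_smul]

variable {G Y} in
lemma lift_comp_smul {T : C} (g : T ⟶ G) (y : T ⟶ Y) : lift g y ≫ γ[G, Y] = g • y := by
  rw [Hom.smul_def]

variable {G Y} in
lemma comp_smul_eq {T : C} (a : T ⟶ G ⊗ Y) : a ≫ γ[G, Y] = (a ≫ fst G Y) • (a ≫ snd G Y) := by
  rw [← lift_comp_smul]
  congr 1
  apply CartesianMonoidalCategory.hom_ext <;> simp

end OrbitMap

/-! ### Orbits and invariant sets -/

section Orbits

variable {k : Type u} [Field k] {G : Over (Spec (.of k))} [GrpObj G]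
  {Y : Over (Spec (.of k))} [ModObj G Y]

lemma apply_smul_mem_orbit {T : Over (Spec (.of k))} (g : T ⟶ G) (y : T ⟶ Y) (t : T.left) :
    (g • y).left t ∈ orbit G Y (y.left t) := by
  refine ⟨(lift g y).left t, ?_, ?_⟩
  · rw [Set.mem_preimage, ← Scheme.Hom.comp_apply, ← Over.comp_left, lift_snd]
    rfl
  · rw [← Scheme.Hom.comp_apply, ← Over.comp_left, lift_comp_smul]

lemma mem_orbit_self (y : Y.left) : y ∈ orbit G Y y := by
  have := apply_smul_mem_orbit (1 : Y ⟶ G) (𝟙 Y) y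
  rwa [one_smul] at this

lemma mem_orbit_symm {y z : Y.left} (h : z ∈ orbit G Y y) : y ∈ orbit G Y z := by
  obtain ⟨ξ, hξ, rfl⟩ := h
  refine ⟨(swapAction G Y).hom.left ξ, ?_, ?_⟩
  · rw [Set.mem_preimage, ← Scheme.Hom.comp_apply, ← Over.comp_left, swapAction_hom_snd]
    rfl
  · rw [← Scheme.Hom.comp_apply, ← Over.comp_left, swapAction_hom_smul]
    exact hξ

lemma mem_orbit_trans {y z w : Y.left} (h : z ∈ orbit G Y y) (h' : w ∈ orbit G Y z) :
    w ∈ orbit G Y y := by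
  obtain ⟨ξ, hξ, rfl⟩ := h
  obtain ⟨ξ', hξ', rfl⟩ := h'
  obtain ⟨θ, rfl, rfl⟩ := Scheme.exists_preimage_of_isPullback
    (isPullback_left (IsPullback.of_hasPullback γ[G, Y] (snd G Y))) ξ ξ' hξ'.symm
  let a := pullback.fst γ[G, Y] (snd G Y)
  let b := pullback.snd γ[G, Y] (snd G Y)
  have hab : (a ≫ fst G Y) • (a ≫ snd G Y) = b ≫ snd G Y := by
    rw [← comp_smul_eq]
    exact pullback.condition
  have := apply_smul_mem_orbit ((b ≫ fst G Y) * (a ≫ fst G Y)) (a ≫ snd G Y) θ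
  rw [mul_smul, hab, ← comp_smul_eq] at this
  simp only [Over.comp_left, Scheme.Hom.comp_apply] at this
  rwa [show (snd G Y).left (a.left θ) = y from hξ] at this

/-- The union of the orbits of the points of a set. -/
def saturation (G : Over (Spec (.of k))) [GrpObj G] (Y : Over (Spec (.of k))) [ModObj G Y]
    (A : Set Y.left) : Set Y.left :=
  (γ[G, Y] : G ⊗ Y ⟶ Y).left '' ((snd G Y).left ⁻¹' A)

lemma mem_saturation {A : Set Y.left} {z : Y.left} :
    z ∈ saturation G Y A ↔ ∃ y ∈ A, z ∈ orbit G Y y := by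
  constructor
  · rintro ⟨ξ, h, rfl⟩
    exact ⟨_, h, ξ, rfl, rfl⟩
  · rintro ⟨y, h, ξ, rfl, rfl⟩
    exact ⟨ξ, h, rfl⟩

/-- A set of points of `Y` is invariant if it contains the orbits of its points. -/
def IsInvariant (G : Over (Spec (.of k))) [GrpObj G] (Y : Over (Spec (.of k))) [ModObj G Y]
    (A : Set Y.left) : Prop :=
  ∀ y ∈ A, orbit G Y y ⊆ A

lemma isInvariant_saturation (A : Set Y.left) : IsInvariant G Y (saturation G Y A) := by
  intro z hz w hw
  obtain ⟨y, hy, hyz⟩ := mem_saturation.mp hz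
  exact mem_saturation.mpr ⟨y, hy, mem_orbit_trans hyz hw⟩

variable [IsFinite G.hom]

instance : IsFinite (snd G Y).left :=
  MorphismProperty.of_isPullback (isPullback_tensor_left G Y) ‹_›

instance : Flat (snd G Y).left := by
  have : Flat G.hom := inferInstance
  exact MorphismProperty.of_isPullback (isPullback_tensor_left G Y) ‹_›

instance : IsFinite (γ[G, Y] : G ⊗ Y ⟶ Y).left := by
  have : IsIso (swapAction G Y).hom.left :=
    inferInstanceAs (IsIso ((Over.forget _).map (swapAction G Y).hom))
  rw [← swapAction_hom_snd, Over.comp_left]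
  infer_instance

instance : Flat (γ[G, Y] : G ⊗ Y ⟶ Y).left := by
  have : IsIso (swapAction G Y).hom.left :=
    inferInstanceAs (IsIso ((Over.forget _).map (swapAction G Y).hom))
  rw [← swapAction_hom_snd, Over.comp_left]
  infer_instance

lemma isClosed_saturation {A : Set Y.left} (hA : IsClosed A) : IsClosed (saturation G Y A) :=
  (γ[G, Y] : G ⊗ Y ⟶ Y).left.isClosedMap _ (hA.preimage (snd G Y).left.continuous)

lemma isOpen_saturation {A : Set Y.left} (hA : IsOpen A) : IsOpen (saturation G Y A) := by
  have : IsIso (swapAction G Y).hom.left :=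
    inferInstanceAs (IsIso ((Over.forget _).map (swapAction G Y).hom))
  have : LocallyOfFinitePresentation G.hom :=
    LocallyOfFinitePresentation.iff_locallyOfFiniteType.mpr inferInstance
  have : LocallyOfFinitePresentation (snd G Y).left :=
    MorphismProperty.of_isPullback (isPullback_tensor_left G Y) ‹_›
  have : LocallyOfFinitePresentation (γ[G, Y] : G ⊗ Y ⟶ Y).left := by
    rw [← swapAction_hom_snd, Over.comp_left]
    infer_instance
  exact (γ[G, Y] : G ⊗ Y ⟶ Y).left.isOpenMap _ (hA.preimage (snd G Y).left.continuous)

/-- The orbit of a generic point `y` of an irreducible component of `S` contains no proper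
specialisation of `y`: going down along the flat projection `G × Y ⟶ Y` would produce two points of
`G × Y`, one specialising to the other, in the same fibre of the finite action map. -/
lemma eq_of_specializes_of_mem_orbit {S : Set Y.left} (hS : IsInvariant G Y S) {y c : Y.left}
    (hy : ∀ z ∈ S, z ⤳ y → z = y) (hyS : y ∈ S) (hyc : y ⤳ c) (hc : c ∈ orbit G Y y) : c = y := by
  obtain ⟨ξ, hξ, hξ'⟩ := mem_orbit_symm hc
  obtain ⟨ξ', h1, h2⟩ := Flat.generalizingMap (snd G Y).left (show y ⤳ _ by rwa [hξ])
  have h3 : (γ[G, Y] : G ⊗ Y ⟶ Y).left ξ' = y := by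
    refine hy _ (hS y hyS ⟨ξ', h2, rfl⟩) ?_
    rw [← hξ']
    exact h1.map (γ[G, Y] : G ⊗ Y ⟶ Y).left.continuous
  have h4 := (γ[G, Y] : G ⊗ Y ⟶ Y).left.isDiscrete_preimage_singleton y
  have h5 : ξ' = ξ := h4.eq_of_specializes h1 h3 hξ'
  rw [← hξ, ← h5, h2]

end Orbits

/-! ### Integral closed subschemes -/

section PointClosures

variable {k : Type u} [Field k] {Y : Over (Spec (.of k))}

/-- Every point is the generic point of an integral closed subscheme. -/
lemma exists_isIntegral_genericPoint_eq (hY : IsVariety Y) (y : Y.left) :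
    ∃ (C : Over (Spec (.of k))) (_ : IsIntegral C.left) (c : C ⟶ Y), IsClosedImmersion c.left ∧
      c.left (genericPoint C.left) = y := by
  have := hY.isNoetherian
  let g := Y.left.fromSpecResidueField y
  have : QuasiCompact g := inferInstance
  have : IsSchemeTheoreticallyDominant g.toImage := isSchemeTheoreticallyDominant_toImage g
  have : IsReduced g.image := IsSchemeTheoreticallyDominant.isReduced g.toImage
  let pt := genericPoint (Spec (Y.left.residueField y))
  have hpt : IsGenericPoint (g.toImage pt) Set.univ := by
    have h := (genericPoint_spec (Spec (Y.left.residueField y))).image g.toImage.continuous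
    rwa [Set.image_univ, g.toImage.denseRange.closure_range] at h
  have : IrreducibleSpace g.image := (irreducibleSpace_def _).mpr hpt.isIrreducible
  have : IsIntegral g.image := isIntegral_of_irreducibleSpace_of_isReduced _
  have hy : g.imageι (genericPoint g.image) = y := by
    rw [(genericPoint_spec g.image).eq hpt, ← Scheme.Hom.comp_apply, Scheme.Hom.toImage_imageι]
    exact Scheme.fromSpecResidueField_apply _ _
  have hc : IsClosedImmersion g.imageι := inferInstance
  exact ⟨Over.mk (g.imageι ≫ Y.hom), ‹_›, Over.homMk g.imageι, hc, hy⟩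

end PointClosures

/-! ### Images of orbit maps -/

section OrbitMapOfSubvariety

/-- A base change of `h` along a morphism which lands in `V` only sees `h` over `V`. -/
lemma flat_of_isPullback_of_forall_mem {R C P T : Scheme.{u}} {h : R ⟶ C} {V : C.Opens}
    [Flat (h ∣_ V)] {a : P ⟶ R} {b : P ⟶ T} {s : T ⟶ C} (sq : IsPullback a b h s)
    (hs : ∀ t, s t ∈ V) : Flat b := by
  have hs' : Set.range s ⊆ Set.range V.ι := by
    rintro _ ⟨t, rfl⟩
    rw [Scheme.Opens.range_ι]
    exact hs t
  have h1 := (isPullback_morphismRestrict h V).flip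
  have h2 : s = IsOpenImmersion.lift V.ι s hs' ≫ V.ι := (IsOpenImmersion.lift_fac _ _ _).symm
  have h3 : a ≫ h = (b ≫ IsOpenImmersion.lift V.ι s hs') ≫ V.ι := by
    rw [Category.assoc, ← h2, sq.w]
  have h4 : IsPullback (h1.lift a (b ≫ IsOpenImmersion.lift V.ι s hs') h3) b (h ∣_ V)
      (IsOpenImmersion.lift V.ι s hs') :=
    .of_right (by rwa [h1.lift_fst, ← h2]) (h1.lift_snd _ _ _) h1
  exact MorphismProperty.of_isPullback h4 ‹_›

lemma surjective_toImage {X Y : Scheme.{u}} (f : X ⟶ Y) [IsFinite f] : Surjective f.toImage := by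
  have : IsFinite (f.toImage ≫ f.imageι) := by rwa [Scheme.Hom.toImage_imageι]
  have : IsFinite f.toImage := .of_comp _ f.imageι
  refine ⟨fun x ↦ ?_⟩
  have h1 := f.toImage.isClosedMap.isClosed_range.closure_eq
  rw [f.toImage.denseRange.closure_range] at h1
  have : x ∈ Set.range f.toImage := h1 ▸ Set.mem_univ x
  exact this

variable {k : Type u} [Field k] {G : Over (Spec (.of k))} [GrpObj G]
  {Y C : Over (Spec (.of k))} [ModObj G Y]

/-- The orbit map `(g, c) ↦ g • c` of a morphism `C ⟶ Y`. -/
noncomputable abbrev orbitMap (G : Over (Spec (.of k))) [GrpObj G]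
    {Y C : Over (Spec (.of k))} [ModObj G Y] (c : C ⟶ Y) : G ⊗ C ⟶ Y :=
  fst G C • (snd G C ≫ c)

lemma comp_orbitMap (c : C ⟶ Y) {T : Over (Spec (.of k))} (t : T ⟶ G ⊗ C) :
    t ≫ orbitMap G c = (t ≫ fst G C) • ((t ≫ snd G C) ≫ c) := by
  rw [ModObj.comp_smul, Category.assoc]

lemma isPullback_whiskerLeft {D : Type*} [Category D] [CartesianMonoidalCategory D] {G C Y : D}
    (c : C ⟶ Y) : IsPullback (G ◁ c) (snd G C) (snd G Y) c := by
  refine ⟨⟨by simp⟩, ⟨PullbackCone.IsLimit.mk _ (fun s ↦ lift (s.fst ≫ fst G Y) s.snd)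
    (fun s ↦ ?_) (fun s ↦ ?_) (fun s m h1 h2 ↦ ?_)⟩⟩
  · apply CartesianMonoidalCategory.hom_ext <;> simp [s.condition]
  · simp
  · apply CartesianMonoidalCategory.hom_ext
    · simp [← h1]
    · simpa using h2

lemma range_orbitMap (c : C ⟶ Y) :
    Set.range (orbitMap G c).left = saturation G Y (Set.range c.left) := by
  ext z
  constructor
  · rintro ⟨ξ, rfl⟩
    refine mem_saturation.mpr ⟨_, ⟨(snd G C).left ξ, rfl⟩, ?_⟩
    exact apply_smul_mem_orbit (fst G C) (snd G C ≫ c) ξ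
  · rintro ⟨ξ', ⟨x, hx⟩, rfl⟩
    obtain ⟨ξ, rfl, -⟩ := Scheme.exists_preimage_of_isPullback
      (isPullback_left (isPullback_whiskerLeft (G := G) c)) ξ' x hx.symm
    refine ⟨ξ, ?_⟩
    have : G ◁ c ≫ γ[G, Y] = orbitMap G c := by rw [comp_smul_eq]; simp
    rw [← this]
    rfl

lemma mem_of_smul_mem {U : Set Y.left} (hU : IsInvariant G Y U) {T : Over (Spec (.of k))}
    {g : T ⟶ G} {y : T ⟶ Y} {t : T.left} (h : (g • y).left t ∈ U) : y.left t ∈ U :=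
  hU _ h (mem_orbit_symm (apply_smul_mem_orbit g y t))

lemma isPullback_of_points {D : Type*} [Category D] {P X Y Z : D} {p : P ⟶ X} {q : P ⟶ Y}
    {f : X ⟶ Z} {g : Y ⟶ Z} (w : p ≫ f = q ≫ g)
    (h : ∀ {T : D} (x : T ⟶ X) (y : T ⟶ Y), x ≫ f = y ≫ g → ∃ l : T ⟶ P, l ≫ p = x ∧ l ≫ q = y)
    (hu : ∀ {T : D} (l l' : T ⟶ P), l ≫ p = l' ≫ p → l ≫ q = l' ≫ q → l = l') :
    IsPullback p q f g :=
  ⟨⟨w⟩, ⟨PullbackCone.IsLimit.mk _ (fun s ↦ (h s.fst s.snd s.condition).choose)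
    (fun s ↦ (h s.fst s.snd s.condition).choose_spec.1)
    (fun s ↦ (h s.fst s.snd s.condition).choose_spec.2)
    (fun s _ h1 h2 ↦ hu _ _ (h1.trans (h s.fst s.snd s.condition).choose_spec.1.symm)
      (h2.trans (h s.fst s.snd s.condition).choose_spec.2.symm))⟩⟩

/-- Let `W` be the part of `C ⊆ Y` in an invariant open `U`, and let `π : G × W ⟶ Z` be the orbit
map into a subscheme `Z` of `Y`. The fibre product `(G × W) ×_Z (G × W)` consists of the
`(g₁, w₁, g₂, w₂)` with `g₁ • w₁ = g₂ • w₂`, so it is pulled back along `(g₂, w₂) ↦ w₂` from the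
scheme `R` of the `(g, c, c')` with `g • c = c'`, via `g = g₂⁻¹ * g₁`. So it is flat over `G × W`
if `R` is flat over a neighbourhood of `W` in `C`. -/
lemma flat_pullback_snd_orbitMap {c : C ⟶ Y} {V : C.left.Opens} [IsClosedImmersion c.left]
    [Flat ((pullback.snd (orbitMap G c) c).left ∣_ V)] {U : Y.left.Opens}
    (hU : IsInvariant G Y U) (hUV : c.left ⁻¹ᵁ U ≤ V) {W Z : Over (Spec (.of k))} (w : W ⟶ C)
    [Mono w] (hwU : ∀ x, (w ≫ c).left x ∈ U)
    (hw : ∀ {T : Over (Spec (.of k))} (t : T ⟶ C), (∀ x, (t ≫ c).left x ∈ U) →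
      ∃ t' : T ⟶ W, t' ≫ w = t) (j : Z ⟶ Y) [Mono j] (π : G ⊗ W ⟶ Z)
    (hπ : π ≫ j = orbitMap G (w ≫ c)) :
    Flat (pullback.snd π π).left := by
  have : Mono c := Over.mono_of_mono_left _
  have hπ' {T : Over (Spec (.of k))} (t : T ⟶ G ⊗ W) :
      t ≫ π ≫ j = (t ≫ fst G W) • (t ≫ snd G W ≫ w ≫ c) := by
    rw [hπ, comp_orbitMap, Category.assoc]
  have hcond : (pullback.fst π π ≫ fst G W) • (pullback.fst π π ≫ snd G W ≫ w ≫ c) =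
      (pullback.snd π π ≫ fst G W) • (pullback.snd π π ≫ snd G W ≫ w ≫ c) := by
    rw [← hπ', ← hπ', pullback.condition_assoc]
  have hρ : lift ((pullback.snd π π ≫ fst G W)⁻¹ * (pullback.fst π π ≫ fst G W))
      (pullback.fst π π ≫ snd G W ≫ w) ≫ orbitMap G c =
      (pullback.snd π π ≫ snd G W ≫ w) ≫ c := by
    rw [comp_orbitMap, lift_fst, lift_snd, mul_smul, Category.assoc, Category.assoc, hcond,
      inv_smul_smul, Category.assoc, Category.assoc]
  have sq : IsPullback (pullback.lift _ _ hρ) (pullback.snd π π)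
      (pullback.snd (orbitMap G c) c) (snd G W ≫ w) := by
    refine isPullback_of_points (by rw [pullback.lift_snd]) (fun {T} r s h ↦ ?_)
      (fun l l' h1 h2 ↦ ?_)
    · have h1 : (r ≫ pullback.fst _ _ ≫ fst G C) • (r ≫ pullback.fst _ _ ≫ snd G C ≫ c) =
          s ≫ snd G W ≫ w ≫ c := by
        have := r ≫= pullback.condition (f := orbitMap G c) (g := c)
        rw [← Category.assoc, comp_orbitMap, reassoc_of% h] at this
        simpa using this
      obtain ⟨x, hx⟩ := hw (r ≫ pullback.fst _ _ ≫ snd G C) (fun t ↦ by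
        refine mem_of_smul_mem hU (g := r ≫ pullback.fst _ _ ≫ fst G C) ?_
        rw [Category.assoc, Category.assoc, h1]
        exact hwU ((s ≫ snd G W).left t))
      have h2 : lift ((s ≫ fst G W) * (r ≫ pullback.fst _ _ ≫ fst G C)) x ≫ π = s ≫ π := by
        rw [← cancel_mono j, Category.assoc, Category.assoc, hπ', hπ', lift_fst, lift_snd_assoc,
          reassoc_of% hx, mul_smul, h1]
      refine ⟨pullback.lift _ _ h2, ?_, pullback.lift_snd _ _ _⟩
      apply pullback.hom_ext
      · rw [Category.assoc, pullback.lift_fst, comp_lift]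
        apply CartesianMonoidalCategory.hom_ext
        · rw [lift_fst, MonObj.comp_mul, GrpObj.comp_inv, pullback.lift_fst_assoc,
            pullback.lift_snd_assoc, lift_fst, inv_mul_cancel_left, Category.assoc]
        · rw [lift_snd, pullback.lift_fst_assoc, lift_snd_assoc, hx, Category.assoc]
      · rw [Category.assoc, pullback.lift_snd, pullback.lift_snd_assoc, h]
    · apply pullback.hom_ext _ h2
      have h3 := h1 =≫ pullback.fst _ _
      rw [Category.assoc, Category.assoc, pullback.lift_fst, comp_lift, comp_lift] at h3
      have h4 := h3 =≫ fst _ _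
      have h5 := h3 =≫ snd _ _
      rw [lift_fst, lift_fst, MonObj.comp_mul, MonObj.comp_mul, GrpObj.comp_inv,
        GrpObj.comp_inv, reassoc_of% h2] at h4
      rw [lift_snd, lift_snd] at h5
      apply CartesianMonoidalCategory.hom_ext
      · simpa using mul_left_cancel h4
      · rw [← cancel_mono w]
        simpa using h5
  exact flat_of_isPullback_of_forall_mem (isPullback_left sq)
    (fun t ↦ hUV (hwU ((snd G W).left t)))

variable [IsFinite G.hom]

instance (c : C ⟶ Y) [IsClosedImmersion c.left] : IsFinite (orbitMap G c).left := by
  have h := isPullback_left (isPullback_whiskerLeft (G := G) c)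
  have : IsClosedImmersion (G ◁ c).left := MorphismProperty.of_isPullback h.flip ‹_›
  have : G ◁ c ≫ γ[G, Y] = orbitMap G c := by rw [comp_smul_eq]; simp
  rw [← this, Over.comp_left]
  infer_instance

/-- The orbit map of an open piece `W` of a closed subscheme `C` of `Y` is faithfully flat onto its
scheme-theoretic image `Z`, provided that the scheme of the `(g, c, c')` with `g • c = c'` is flat
over `W` by the last projection. The open `U` is invariant, so the orbit map is finite over `U`, and
flatness descends along it. -/
lemma exists_immersion_orbitMap (c : C ⟶ Y) {V : C.left.Opens} [IsClosedImmersion c.left]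
    [Flat ((pullback.snd (orbitMap G c) c).left ∣_ V)] {U : Y.left.Opens}
    (hU : IsInvariant G Y U) (hUV : c.left ⁻¹ᵁ U ≤ V) :
    ∃ (Z : Over (Spec (.of k))) (j : Z ⟶ Y) (π : G ⊗ opensOver C (c.left ⁻¹ᵁ U) ⟶ Z),
      IsImmersion j.left ∧ π ≫ j = orbitMap G (opensι C (c.left ⁻¹ᵁ U) ≫ c) ∧ Flat π.left ∧
        Surjective π.left ∧ QuasiCompact π.left := by
  set W := opensOver C (c.left ⁻¹ᵁ U)
  set w := opensι C (c.left ⁻¹ᵁ U)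
  have hw {T : Over (Spec (.of k))} (t : T ⟶ C) (ht : ∀ x, (t ≫ c).left x ∈ U) :
      ∃ t' : T ⟶ W, t' ≫ w = t := exists_comp_opensι_eq _ t ht
  have hmem (ξ) : (orbitMap G (w ≫ c)).left ξ ∈ U := by
    refine hU _ ?_ (apply_smul_mem_orbit (fst G W) (snd G W ≫ w ≫ c) ξ)
    exact ((snd G W).left ξ).2
  obtain ⟨π₀, hπ₀⟩ := exists_comp_opensι_eq U (orbitMap G (w ≫ c)) hmem
  have sq₀ : IsPullback (G ◁ w) π₀ (orbitMap G c) (opensι Y U) := by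
    refine isPullback_of_points ?_ (fun {T} t s h ↦ ?_) (fun l l' h1 h2 ↦ ?_)
    · rw [hπ₀, comp_orbitMap]
      simp
    · rw [comp_orbitMap] at h
      obtain ⟨x, hx⟩ := hw (t ≫ snd G C) (fun t' ↦ by
        refine mem_of_smul_mem hU (g := t ≫ fst G C) ?_
        rw [h]
        exact (s.left t').2)
      refine ⟨lift (t ≫ fst G C) x, ?_, ?_⟩
      · apply CartesianMonoidalCategory.hom_ext <;> simp [hx]
      · rw [← cancel_mono (opensι Y U), Category.assoc, hπ₀, comp_orbitMap, lift_fst, lift_snd,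
          reassoc_of% hx, ← h, Category.assoc]
    · apply CartesianMonoidalCategory.hom_ext
      · simpa using h1 =≫ fst _ _
      · rw [← cancel_mono w]
        simpa using h1 =≫ snd _ _
  have : IsFinite π₀.left := MorphismProperty.of_isPullback (isPullback_left sq₀) inferInstance
  have hfac := π₀.left.toImage_imageι
  have hover : π₀.left ≫ U.ι ≫ Y.hom = (G ⊗ W).hom := Over.w π₀
  let Z : Over (Spec (.of k)) := Over.mk (π₀.left.imageι ≫ U.ι ≫ Y.hom)
  let j₀ : Z ⟶ opensOver Y U := Over.homMk π₀.left.imageι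
  let π : G ⊗ W ⟶ Z := Over.homMk π₀.left.toImage (by
    rw [← hover, ← reassoc_of% hfac]; rfl)
  have hπj₀ : π ≫ j₀ = π₀ := by
    ext
    exact hfac
  have hj : IsImmersion (j₀ ≫ opensι Y U).left := by
    change IsImmersion (π₀.left.imageι ≫ U.ι)
    infer_instance
  have : Mono (j₀ ≫ opensι Y U) := Over.mono_of_mono_left _
  have hπ : π ≫ j₀ ≫ opensι Y U = orbitMap G (w ≫ c) := by rw [reassoc_of% hπj₀, hπ₀]
  have hfin : IsFinite π.left := by
    have : IsFinite (π.left ≫ π₀.left.imageι) := by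
      change IsFinite (π₀.left.toImage ≫ π₀.left.imageι)
      rwa [hfac]
    exact .of_comp _ π₀.left.imageι
  have : IsSchemeTheoreticallyDominant π.left := isSchemeTheoreticallyDominant_toImage π₀.left
  have : Flat (pullback.snd π π).left :=
    flat_pullback_snd_orbitMap hU hUV w (fun x ↦ x.2) hw (j₀ ≫ opensι Y U) π hπ
  exact ⟨Z, j₀ ≫ opensι Y U, π, hj, hπ,
    flat_of_isPullback_self (isPullback_left (.of_hasPullback π π)),
    surjective_toImage π₀.left, inferInstance⟩

end OrbitMapOfSubvariety

/-! ### Construction of a stratum -/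

section Strata

open TopologicalSpace in
/-- The point `y` is the generic point of an irreducible component of `S`. -/
lemma exists_isOpen_inter_subset_closure_singleton {α : Type*} [TopologicalSpace α]
    [NoetherianSpace α] [QuasiSober α] {S : Set α} (hS : IsClosed S) (hne : S.Nonempty) :
    ∃ y ∈ S, ∃ V : Set α, IsOpen V ∧ y ∈ V ∧ V ∩ S ⊆ closure {y} := by
  have : Nonempty S := hne.to_subtype
  have : NoetherianSpace S := Topology.IsInducing.subtypeVal.noetherianSpace
  have : QuasiSober S := hS.isClosedEmbedding_subtypeVal.quasiSober
  obtain ⟨x⟩ := ‹Nonempty S›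
  obtain ⟨o, ho, ⟨z, hz⟩, hoZ⟩ :=
    NoetherianSpace.exists_isOpen_nonempty_subset_irreducibleComponent _
      (irreducibleComponent_mem_irreducibleComponents x)
  have hirr : IsIrreducible (irreducibleComponent x) := isIrreducible_irreducibleComponent
  have hcl : closure {hirr.genericPoint} = irreducibleComponent x := by
    rw [hirr.genericPoint_closure_eq, isClosed_irreducibleComponent.closure_eq]
  obtain ⟨V, hV, rfl⟩ := isOpen_induced_iff.mp ho
  have hspec : ∀ t ∈ irreducibleComponent x, hirr.genericPoint ⤳ t := fun t ht ↦ by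
    rw [specializes_iff_mem_closure, hcl]; exact ht
  refine ⟨hirr.genericPoint, hirr.genericPoint.2, V, hV,
    (hspec z (hoZ hz)).mem_open ho hz, ?_⟩
  rintro t ⟨htV, htS⟩
  rw [← specializes_iff_mem_closure]
  exact (hspec ⟨t, htS⟩ (hoZ htV)).map continuous_subtype_val

variable {k : Type u} [Field k] {G : Over (Spec (.of k))} [GrpObj G] {X Y F : Over (Spec (.of k))}
  [ModObj G X] [ModObj G F] (f : X ⟶ Y)

lemma TrivialAlong.pointι_comp {C : Over (Spec (.of k))} (c : C ⟶ Y) (ξ : C.left)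
    (h : TrivialAlong G f F (pointι Y (c.left ξ))) : TrivialAlong G f F (pointι C ξ ≫ c) := by
  let p : point C ξ ⟶ point Y (c.left ξ) :=
    Over.homMk (Spec.map (c.left.residueFieldMap ξ)) (by
      change _ ≫ Y.left.fromSpecResidueField _ ≫ Y.hom = C.left.fromSpecResidueField ξ ≫ C.hom
      rw [Scheme.Hom.SpecMap_residueFieldMap_fromSpecResidueField_assoc, Over.w])
  have hp : pointι C ξ ≫ c = p ≫ pointι Y (c.left ξ) := by
    ext
    exact (Scheme.Hom.SpecMap_residueFieldMap_fromSpecResidueField _ _).symm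
  rw [hp]
  exact h.comp p

variable [ModObj G Y] [IsModHom G f]

/-- Near the generic point `y` of an irreducible component of `S`, the orbit of a small open piece
`W` of the closure `C` of `y` is a stratum, open in `S`. -/
lemma exists_stratum [IsFinite G.hom] (hX : IsVariety X) (hY : IsVariety Y) (hF : IsVariety F)
    (htriv : ∀ y, FibreIsTrivial G f F y) {S : Set Y.left} (hS : IsClosed S)
    (hinv : IsInvariant G Y S) (hne : S.Nonempty) :
    ∃ (B : Over (Spec (.of k))) (j : B ⟶ Y) (_ : ModObj G B) (_ : IsModHom G j),
      IsImmersion j.left ∧ (∃ φ : pullback f j ≅ B ⊗ F,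
        IsModHom G φ.hom ∧ φ.hom ≫ fst B F = pullback.snd f j) ∧
      (Set.range j.left).Nonempty ∧ Set.range j.left ⊆ S ∧ IsClosed (S \ Set.range j.left) ∧
      IsInvariant G Y (S \ Set.range j.left) := by
  have hG : IsVariety G := isVariety_of_isFinite
  have := hY.isNoetherian
  obtain ⟨y, hyS, V₂, hV₂, hyV₂, hV₂S⟩ := exists_isOpen_inter_subset_closure_singleton hS hne
  -- `y` has no proper generisation in `S`.
  have hmax : ∀ z ∈ S, z ⤳ y → z = y := fun z hz hzy ↦
    (hzy.antisymm (specializes_iff_mem_closure.mpr (hV₂S ⟨hzy.mem_open hV₂ hyV₂, hz⟩))).eq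
  obtain ⟨C, hCi, c, hc, hcξ⟩ := exists_isIntegral_genericPoint_eq hY y
  set ξ := genericPoint C.left
  have hC : IsVariety C := isVariety_of_hom hY c
  have := hC.isNoetherian
  have hinj : Function.Injective c.left := c.left.isClosedEmbedding.injective
  have hspec (x : C.left) : y ⤳ c.left x := by
    rw [← hcξ]
    exact (genericPoint_specializes x).map c.left.continuous
  have horb {x x' : C.left} (h : c.left x' ∈ orbit G Y (c.left x)) (hx : x = ξ) : x' = ξ := by
    subst hx
    apply hinj
    rw [hcξ] at h ⊢
    exact eq_of_specializes_of_mem_orbit hinv hmax hyS (hspec x') h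
  -- The trivialisation lives on `Va`, flatness on `Vb`, and `C` is all of `S` on `V₂`.
  obtain ⟨Va, hVa⟩ := exists_trivialAlong_opensι (f := f) (F := F) hG hX hY hF hC c
    (fun {T} g w w' h hw x ↦ by
      refine horb (x := w.left x) ?_ (hw x)
      have := apply_smul_mem_orbit g (w ≫ c) x
      rw [h] at this
      exact this)
    (.pointι_comp f c ξ ((fibreIsTrivial_iff _).mp (htriv _)))
  have : IsFinite (pullback.snd (orbitMap G c) c).left :=
    MorphismProperty.of_isPullback (isPullback_left (.of_hasPullback (orbitMap G c) c))
      inferInstance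
  obtain ⟨Vb, hξb, hVb⟩ := exists_opens_flat (pullback.snd (orbitMap G c) c).left
  let V : C.left.Opens := Va.1 ⊓ Vb ⊓ c.left ⁻¹ᵁ ⟨V₂, hV₂⟩
  have hξV : ξ ∈ V := ⟨⟨Va.2.2, hξb⟩, show c.left ξ ∈ V₂ by rwa [hcξ]⟩
  -- The largest invariant open of `Y` whose intersection with `C` lies in `V`.
  let U : Y.left.Opens := ⟨(saturation G Y (c.left '' (V : Set C.left)ᶜ))ᶜ,
    (isClosed_saturation (c.left.isClosedEmbedding.isClosedMap _
      V.isOpen.isClosed_compl)).isOpen_compl⟩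
  have hU : IsInvariant G Y U := by
    intro z hz z' hz' h
    exact hz (isInvariant_saturation _ _ h (mem_orbit_symm hz'))
  have hyU : y ∈ U := by
    intro h
    obtain ⟨_, ⟨v, hv, rfl⟩, h⟩ := mem_saturation.mp h
    refine hv ?_
    rw [horb (x := ξ) (x' := v) (by rw [hcξ]; exact mem_orbit_symm h) rfl]
    exact hξV
  have hUV : c.left ⁻¹ᵁ U ≤ V := by
    intro x hx
    by_contra h
    exact hx (mem_saturation.mpr ⟨_, ⟨x, h, rfl⟩, mem_orbit_self _⟩)
  obtain ⟨B, j, π, hj, hπ, _, _, _⟩ := exists_immersion_orbitMap c hU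
    (hUV.trans (inf_le_left.trans inf_le_right))
  set w := opensι C (c.left ⁻¹ᵁ U)
  have : Mono j := Over.mono_of_mono_left _
  have hepi {P : Over (Spec (.of k))} (z : P ⟶ B) : EffectiveEpi (pullback.fst z π) :=
    effectiveEpi_pullback_fst π z
  have hπ' : π ≫ j = fst G _ • (snd G _ ≫ w ≫ c) := hπ
  have := hepi (snd G B)
  obtain ⟨_, _⟩ := exists_action_of_effectiveEpi hπ'
  have htw : TrivialAlong G f F (w ≫ c) := by
    obtain ⟨w', hw'⟩ := exists_comp_opensι_eq Va.1 w
      (fun x ↦ (hUV x.2).1.1)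
    rw [← hw', Category.assoc]
    exact hVa.comp w'
  have hrange : Set.range j.left = saturation G Y (Set.range (w ≫ c).left) := by
    rw [← range_orbitMap, ← hπ, Over.comp_left, Scheme.Hom.comp_base, TopCat.coe_comp,
      Set.range_comp, π.left.surjective.range_eq, Set.image_univ]
  have hrangew : Set.range (w ≫ c).left = Set.range c.left ∩ U := by
    ext z
    constructor
    · rintro ⟨x, rfl⟩
      exact ⟨⟨x.1, rfl⟩, x.2⟩
    · rintro ⟨⟨x, rfl⟩, hx⟩
      exact ⟨⟨x, hx⟩, rfl⟩
  have hcl : closure {y} ⊆ Set.range c.left :=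
    closure_minimal (Set.singleton_subset_iff.mpr ⟨ξ, hcξ⟩)
      c.left.isClosedEmbedding.isClosed_range
  have hrange' : Set.range j.left = S ∩ saturation G Y (V₂ ∩ U) := by
    rw [hrange, hrangew]
    ext z
    constructor
    · intro h
      obtain ⟨_, ⟨⟨x, rfl⟩, hx⟩, h⟩ := mem_saturation.mp h
      exact ⟨hinv _ ((hspec x).mem_closed hS hyS) h,
        mem_saturation.mpr ⟨_, ⟨(hUV hx).2, hx⟩, h⟩⟩
    · rintro ⟨hz, h⟩
      obtain ⟨u, ⟨hu, hu'⟩, h⟩ := mem_saturation.mp h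
      exact mem_saturation.mpr
        ⟨u, ⟨hcl (hV₂S ⟨hu, hinv _ hz (mem_orbit_symm h)⟩), hu'⟩, h⟩
  refine ⟨B, j, ‹_›, ‹_›, hj, (trivialAlong_iff_of_isModHom j).mp (.descend hπ' hepi htw),
    ?_, ?_, ?_, ?_⟩
  · rw [hrange']
    exact ⟨y, hyS, mem_saturation.mpr ⟨y, ⟨hyV₂, hyU⟩, mem_orbit_self y⟩⟩
  · rw [hrange']; exact Set.inter_subset_left
  · rw [hrange', Set.sdiff_self_inter]
    exact hS.sdiff (isOpen_saturation (hV₂.inter U.isOpen))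
  · rintro z ⟨hz, hzj⟩ z' hz'
    refine ⟨hinv _ hz hz', fun h ↦ hzj ?_⟩
    rw [hrange] at h ⊢
    exact isInvariant_saturation _ _ h (mem_orbit_symm hz')

end Strata

/-! ### Construction of the stratification -/

section Stratification

variable {k : Type u} [Field k] {G : Over (Spec (.of k))} [GrpObj G] {X Y F : Over (Spec (.of k))}
  [ModObj G X] [ModObj G Y] [ModObj G F] (f : X ⟶ Y) [IsModHom G f]

variable (G F) in
/-- A `G`-invariant locally closed subscheme `B` of `Y` over which `f : X ⟶ Y` is equivariantly
isomorphic to the projection `B ×_k F ⟶ B`. -/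
structure TrivialStratum where
  B : Over (Spec (.of k))
  emb : B ⟶ Y
  immersion : IsImmersion emb.left
  action : ModObj G B
  equivariant : IsModHom G emb
  trivial : ∃ φ : pullback f emb ≅ B ⊗ F,
    IsModHom G φ.hom ∧ φ.hom ≫ fst B F = pullback.snd f emb

/-- Noetherian induction: a stratum is open in the closed invariant set `S`, and its complement in
`S` is closed and invariant again. -/
lemma exists_stratification_of_isClosed [IsFinite G.hom] (hX : IsVariety X) (hY : IsVariety Y)
    (hF : IsVariety F) (htriv : ∀ y, FibreIsTrivial G f F y)
    (S : TopologicalSpace.Closeds Y.left) (hinv : IsInvariant G Y S) :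
    ∃ (n : ℕ) (B : Fin n → TrivialStratum G F f),
      (∀ i, Set.range (B i).emb.left ⊆ S) ∧ ∀ y ∈ S, ∃! i, y ∈ Set.range (B i).emb.left := by
  have := hY.isNoetherian
  induction S using WellFoundedLT.induction with
  | ind S ih =>
    obtain hS | hS := (S : Set Y.left).eq_empty_or_nonempty
    · exact ⟨0, Fin.elim0, fun i ↦ i.elim0, fun y hy ↦ (hS.subset hy).elim⟩
    obtain ⟨B, j, hB, hjG, hj, hφ, ⟨z, hz⟩, hjS, hcl, hinv'⟩ :=
      exists_stratum f hX hY hF htriv S.isClosed hinv hS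
    obtain ⟨n, L, hLS, hL⟩ := ih ⟨_, hcl⟩
      (lt_of_le_of_ne (fun x hx ↦ hx.1) fun h ↦ (h.ge (hjS hz)).2 hz) hinv'
    refine ⟨n + 1, Fin.cons ⟨B, j, hj, hB, hjG, hφ⟩ L, fun i ↦ ?_, fun y hy ↦ ?_⟩
    · cases i using Fin.cases with
      | zero => exact hjS
      | succ i => exact (hLS i).trans fun x hx ↦ hx.1
    · by_cases hyj : y ∈ Set.range j.left
      · refine ⟨0, hyj, fun i hi ↦ ?_⟩
        cases i using Fin.cases with
        | zero => rfl
        | succ i => exact absurd hyj (hLS i hi).2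
      · obtain ⟨i, hi, huniq⟩ := hL y ⟨hy, hyj⟩
        refine ⟨i.succ, hi, fun i' hi' ↦ ?_⟩
        cases i' using Fin.cases with
        | zero => exact absurd hi' hyj
        | succ i' => exact congrArg Fin.succ (huniq i' hi')

theorem isPiecewiseTrivialFibrationWithFibre_of_fibreIsTrivial [IsFinite G.hom]
    (hX : IsVariety X) (hY : IsVariety Y) (hF : IsVariety F)
    (htriv : ∀ y, FibreIsTrivial G f F y) : IsPiecewiseTrivialFibrationWithFibre G f F := by
  obtain ⟨n, L, -, hL⟩ := exists_stratification_of_isClosed f hX hY hF htriv ⊤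
    fun _ _ ↦ Set.subset_univ _
  exact ⟨{  n := n
            B := fun i ↦ (L i).B
            emb := fun i ↦ (L i).emb
            immersion := fun i ↦ (L i).immersion
            action := fun i ↦ (L i).action
            equivariant := fun i ↦ (L i).equivariant
            partition := fun y ↦ hL y (Set.mem_univ y) }, fun i ↦ (L i).trivial⟩

end Stratification

end EquivariantFibration

theorem theorem2p1 {k : Type u} [Field k] [PerfectField k]
    (G : Over (Spec (.of k))) [GrpObj G] (hG : IsFinite G.hom)
    (X Y : Over (Spec (.of k))) [ModObj G X] [ModObj G Y]
    (hX : EquivariantFibration.IsVariety X) (hY : EquivariantFibration.IsVariety Y)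
    (hGX : EquivariantFibration.IsGoodAction G X) (hGY : EquivariantFibration.IsGoodAction G Y)
    (f : X ⟶ Y) [IsModHom G f] :
    EquivariantFibration.IsPiecewiseTrivialFibration G f ↔
      ∃ (F : Over (Spec (.of k))) (_ : ModObj G F),
        EquivariantFibration.IsVariety F ∧ EquivariantFibration.IsGoodAction G F ∧
        ∀ y : Y.left, EquivariantFibration.FibreIsTrivial G f F y := by
  constructor
  · rintro ⟨F, hGact, hF, hGF, h⟩
    exact ⟨F, hGact, hF, hGF,
      EquivariantFibration.fibreIsTrivial_of_isPiecewiseTrivialFibrationWithFibre h⟩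
  · rintro ⟨F, hGact, hF, hGF, h⟩
    exact ⟨F, hGact, hF, hGF,
      EquivariantFibration.isPiecewiseTrivialFibrationWithFibre_of_fibreIsTrivial f hX hY hF h⟩
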